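/- Let $n\ge 2$ and let $\Omega\subset\mathbb R^n$ be open and bounded. Let $s,p,K:\mathbb R^n\times\mathbb R^n\to\mathbb R$ be measurable and symmetric ($f(x,y)=f(y,x)$ for all $x,y$), with $$0<\inf_{\mathbb R^n\times\mathbb R^n}s\le\sup_{\mathbb R^n\times\mathbb R^n}s<1,\qquad 1<\inf_{\mathbb R^n\times\mathbb R^n}p\le\sup_{\mathbb R^n\times\mathbb R^n}p<\infty,$$ and, for some $\Lambda>1$, $$\frac{\Lambda^{-1}}{|x-y|^{n+s(x,y)p(x,y)}}\le K(x,y)\le\frac{\Lambda}{|x-y|^{n+s(x,y)p(x,y)}}\quad\text{for a.e. }(x,y)\in\mathbb R^n\times\mathbb R^n.$$ For $r>0$ put $$\omega_p(r):=\sup_{B_r\subset\Omega}\ \sup_{x_1,x_2,y_1,y_2\in B_r}|p(x_1,y_1)-p(x_2,y_2)|,$$ the outer supremum being over all open balls of radius $r$ contained in $\Omega$ (and equal to $0$ if there are none), and assume $\lim_{r\to0^+}\omega_p(r)=0$. Let $\mathcal C_\Omega:=(\mathbb R^n\times\mathbb R^n)\setminus((\mathbb R^n\setminus\Omega)\times(\mathbb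 R^n\setminus\Omega))$ and $p^-_\Omega:=\inf_{\Omega\times\Omega}p$. Let $\mathbb W^{s(\cdot,\cdot),p(\cdot,\cdot)}(\Omega)$ be the set of measurable $v:\mathbb R^n\to\mathbb R$ with $$v|_\Omega\in L^{p^-_\Omega}(\Omega)\quad\text{and}\quad\iint_{\mathcal C_\Omega}\frac{|v(x)-v(y)|^{p(x,y)}}{|x-y|^{n+s(x,y)p(x,y)}}\,dy\,dx<\infty,$$ and let $L^\infty(\Omega;L^{p(\cdot,\cdot)-1}_{s(\cdot,\cdot)p(\cdot,\cdot)}(\mathbb R^n))$ be the set of measurable $v:\mathbb R^n\to\mathbb R$ with $$\operatorname*{ess\,sup}_{x\in\Omega}\int_{\mathbb R^n}\frac{|v(y)|^{p(x,y)-1}}{(1+|y|)^{n+s(x,y)p(x,y)}}\,dy<\infty.$$ A function $u\in\mathbb W^{s(\cdot,\cdot),p(\cdot,\cdot)}(\Omega)$ is a weak solution to $$\mathrm{P.V.}\int_{\mathbb R^n}|u(x)-u(y)|^{p(x,y)-2}(u(x)-u(y))K(x,y)\,dy=0\quad\text{in }\Omega$$ if $$\iint_{\mathcal C_\Omega}|u(x)-u(y)|^{p(x,y)-2}(u(x)-u(y))(\phi(x)-\phi(y))K(x,y)\,dy\,dx=0$$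 for every $\phi\in\mathbb W^{s(\cdot,\cdot),p(\cdot,\cdot)}(\Omega)$ with $\phi=0$ a.e. in $\mathbb R^n\setminus\Omega$. If $u\in\mathbb W^{s(\cdot,\cdot),p(\cdot,\cdot)}(\Omega)\cap L^\infty(\Omega;L^{p(\cdot,\cdot)-1}_{s(\cdot,\cdot)p(\cdot,\cdot)}(\mathbb R^n))$ is such a weak solution, then $u\in L^\infty_{\mathrm{loc}}(\Omega)$, that is, $u$ is essentially bounded on every compact subset of $\Omega$. -/

import Mathlib

open MeasureTheory Filter Topology
open scoped ENNReal

namespace VarFrac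

/-- Euclidean space `ℝⁿ`. -/
abbrev Rn (n : ℕ) : Type := EuclideanSpace ℝ (Fin n)

/-- A two-variable function is symmetric. -/
def Symmetric₂ {n : ℕ} (f : Rn n → Rn n → ℝ) : Prop := ∀ x y, f x y = f y x

/-- Lebesgue measurability of a function on `ℝⁿ × ℝⁿ`. -/
def LebesgueMeasurable₂ {n : ℕ} (f : Rn n → Rn n → ℝ) : Prop :=
  AEMeasurable (fun z : Rn n × Rn n => f z.1 z.2) volume

/-- Variable order: `0 < s⁻ = inf s ≤ sup s = s⁺ < 1`. -/
def IsVariableOrder {n : ℕ} (s : Rn n → Rn n → ℝ) : Prop :=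
  ∃ a b : ℝ, IsGLB (Set.range fun z : Rn n × Rn n => s z.1 z.2) a ∧
    IsLUB (Set.range fun z : Rn n × Rn n => s z.1 z.2) b ∧ 0 < a ∧ b < 1

/-- Variable exponent: `1 < p⁻ = inf p ≤ sup p = p⁺ < ∞`. -/
def IsVariableExponent {n : ℕ} (p : Rn n → Rn n → ℝ) : Prop :=
  ∃ a b : ℝ, IsGLB (Set.range fun z : Rn n × Rn n => p z.1 z.2) a ∧
    IsLUB (Set.range fun z : Rn n × Rn n => p z.1 z.2) b ∧ 1 < a

/-- `Λ⁻¹ |x-y|^{-n-s(x,y)p(x,y)} ≤ K(x,y) ≤ Λ |x-y|^{-n-s(x,y)p(x,y)}` for a.e. `(x,y)`. -/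
def KernelBounds {n : ℕ} (s p K : Rn n → Rn n → ℝ) (Λ : ℝ) : Prop :=
  ∀ᵐ z : Rn n × Rn n ∂volume,
    Λ⁻¹ / ‖z.1 - z.2‖ ^ ((n : ℝ) + s z.1 z.2 * p z.1 z.2) ≤ K z.1 z.2 ∧
      K z.1 z.2 ≤ Λ / ‖z.1 - z.2‖ ^ ((n : ℝ) + s z.1 z.2 * p z.1 z.2)

/-- The oscillation `ω_p(r)` near the diagonal: the supremum, over all balls `B` of radius `r`
contained in `Ω` and all `x₁, y₁, x₂, y₂ ∈ B`, of `|p(x₁,y₁) - p(x₂,y₂)|`. -/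
noncomputable def oscDiag {n : ℕ} (p : Rn n → Rn n → ℝ) (Ω : Set (Rn n)) (r : ℝ) : ℝ≥0∞ :=
  ⨆ (x₀ : Rn n) (_ : Metric.ball x₀ r ⊆ Ω),
    ⨆ (x₁ ∈ Metric.ball x₀ r) (y₁ ∈ Metric.ball x₀ r)
      (x₂ ∈ Metric.ball x₀ r) (y₂ ∈ Metric.ball x₀ r), ENNReal.ofReal |p x₁ y₁ - p x₂ y₂|

/-- `𝒞_Ω = (ℝⁿ × ℝⁿ) \ ((ℝⁿ \ Ω) × (ℝⁿ \ Ω))`. -/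
def crossSet {n : ℕ} (Ω : Set (Rn n)) : Set (Rn n × Rn n) := (Ωᶜ ×ˢ Ωᶜ)ᶜ

/-- `p⁻_Ω = inf_{Ω × Ω} p`. -/
noncomputable def expInf {n : ℕ} (p : Rn n → Rn n → ℝ) (Ω : Set (Rn n)) : ℝ :=
  sInf ((fun z : Rn n × Rn n => p z.1 z.2) '' (Ω ×ˢ Ω))

/-- Membership in the space `𝕎^{s(·,·),p(·,·)}(Ω)`. -/
structure MemW {n : ℕ} (s p : Rn n → Rn n → ℝ) (Ω : Set (Rn n)) (v : Rn n → ℝ) : Prop where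
  aemeasurable : AEMeasurable v volume
  memLp : MemLp v (ENNReal.ofReal (expInf p Ω)) (volume.restrict Ω)
  energy_lt_top : (∫⁻ z in crossSet Ω,
    ENNReal.ofReal (|v z.1 - v z.2| ^ p z.1 z.2 /
      ‖z.1 - z.2‖ ^ ((n : ℝ) + s z.1 z.2 * p z.1 z.2))) < ∞

/-- Membership in the tail space with variable powers `L^∞(Ω; L^{p(·,·)-1}_{s(·,·)p(·,·)}(ℝⁿ))`. -/
structure MemTail {n : ℕ} (s p : Rn n → Rn n → ℝ) (Ω : Set (Rn n)) (v : Rn n → ℝ) : Prop where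
  aemeasurable : AEMeasurable v volume
  essSup_lt_top : essSup (fun x : Rn n => ∫⁻ y : Rn n,
    ENNReal.ofReal (|v y| ^ (p x y - 1) / (1 + ‖y‖) ^ ((n : ℝ) + s x y * p x y)))
      (volume.restrict Ω) < ∞

/-- Weak solutions in `Ω` of
`P.V. ∫ |u(x)-u(y)|^{p(x,y)-2} (u(x)-u(y)) K(x,y) dy = 0`. -/
structure IsWeakSolution {n : ℕ} (s p K : Rn n → Rn n → ℝ) (Ω : Set (Rn n))
    (u : Rn n → ℝ) : Prop where
  memW : MemW s p Ω u
  weak_form : ∀ φ : Rn n → ℝ, MemW s p Ω φ → (∀ᵐ x ∂volume.restrict Ωᶜ, φ x = 0) →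
    ∫ z in crossSet Ω, |u z.1 - u z.2| ^ (p z.1 z.2 - 2) * (u z.1 - u z.2) *
      (φ z.1 - φ z.2) * K z.1 z.2 = 0

/-- `u ∈ L^∞_loc(Ω)`: essentially bounded on every compact subset of `Ω`. -/
def MemLinftyLoc {n : ℕ} (Ω : Set (Rn n)) (u : Rn n → ℝ) : Prop :=
  ∀ C : Set (Rn n), IsCompact C → C ⊆ Ω → MemLp u ∞ (volume.restrict C)

end VarFrac

namespace VarFrac

/-! ### Elementary inequalities -/

/-! The proof is a De Giorgi iteration on a ball so small that the variable exponent is almost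
constant. With `τ` a lower bound for both `s` and `1 - s`, continuity of `p` near the diagonal in
the sense of `oscDiag` provides around each point a ball on which `q ≤ p ≤ Q` and `Q ≤ q * (1 + τ *
q / n)`. The integrability gained from a fractional Sobolev inequality with the lower exponent `q`
thus pays for the upper exponent `Q` that the error terms require.

Two estimates carry the iteration. The Caccioppoli estimate (`Admissible.exists_caccioppoli`) bounds
the energy of `(u - k)₊` on a ball by a constant times the integral over a larger ball of the weight
`((u - k)₊^Q + 1) 1_{u > k}`. The test function is `(u - k)₊ η^m` with `m ≥ P`. Nearby pairs are
handled by the algebraic inequality `caccioppoli_pointwise`, distant pairs by the tail hypothesis.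
Since this test function need not lie in the energy space, `(u - k)₊` is truncated at height `M`,
and Fatou's lemma (`lintegral_le_of_tendsto_of_integral_eq_zero`) removes the truncation.

The Sobolev inequality (`exists_lintegral_rpow_le_energy`) needs no case distinction between `s p <
n` and `s p ≥ n`. The value of `f` at a point is compared with its values on a ball of radius `t`,
the variable power `p` is lowered to `q` at the cost of a term supported on `{f ≠ 0}`, and `t` is
then optimised. This gives the modest but sufficient gain from `q` to `q * (1 + τ * q / n)`.

Together they give a recursion `Y (j + 1) ≤ C * b ^ j * Y j ^ κ` with `κ > 1` for the weights at
increasing levels and shrinking radii. Finite energy and one use of the Sobolev inequality put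
`|u|^Q` in `L¹` locally, so `Y 0` is as small as desired once the initial level is high. Hence `Y j
→ 0` and `u` is locally bounded above. The equation is odd, so the same holds for `-u`, and
compactness finishes the proof. -/

lemma rpow_le_one_add_rpow {a p q : ℝ} (ha : 0 ≤ a) (hp : 0 ≤ p) (hpq : p ≤ q) :
    a ^ p ≤ a ^ q + 1 := by
  rcases le_total a 1 with h | h
  · have := Real.rpow_le_one ha h hp
    have := Real.rpow_nonneg ha q
    linarith
  · have := Real.rpow_le_rpow_of_exponent_le h hpq
    linarith

/-- Young's inequality without sharp constants: replace the smaller of `a` and `b` by the larger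
one. -/
lemma rpow_sub_one_mul_le {a b p : ℝ} (ha : 0 ≤ a) (hb : 0 ≤ b) (hp : 1 < p) :
    a ^ (p - 1) * b ≤ a ^ p + b ^ p := by
  rcases le_total a b with h | h
  · have h1 : a ^ (p - 1) ≤ b ^ (p - 1) := Real.rpow_le_rpow ha h (by linarith)
    have h2 : b ^ (p - 1) * b = b ^ p := by
      rcases hb.eq_or_lt with rfl | hb'
      · rw [mul_zero, Real.zero_rpow (by linarith)]
      · rw [← Real.rpow_add_one hb'.ne']; ring_nf
    have := mul_le_mul_of_nonneg_right h1 hb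
    have := Real.rpow_nonneg ha p
    linarith
  · have h2 : a ^ (p - 1) * a = a ^ p := by
      rcases ha.eq_or_lt with rfl | ha'
      · rw [mul_zero, Real.zero_rpow (by linarith)]
      · rw [← Real.rpow_add_one ha'.ne']; ring_nf
    have := mul_le_mul_of_nonneg_left h (Real.rpow_nonneg ha (p - 1))
    have := Real.rpow_nonneg hb p
    linarith

lemma add_rpow_le {a b p : ℝ} (ha : 0 ≤ a) (hb : 0 ≤ b) (hp : 0 ≤ p) :
    (a + b) ^ p ≤ 2 ^ p * (a ^ p + b ^ p) := by
  have h1 : (a + b) ^ p ≤ (2 * max a b) ^ p := by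
    apply Real.rpow_le_rpow (by positivity) _ hp
    have := le_max_left a b
    have := le_max_right a b
    linarith
  rw [Real.mul_rpow (by norm_num) (le_max_of_le_left ha)] at h1
  refine h1.trans (mul_le_mul_of_nonneg_left ?_ (by positivity))
  have := Real.rpow_nonneg ha p
  have := Real.rpow_nonneg hb p
  rcases max_choice a b with h | h <;> rw [h] <;> linarith

/-- The nonlinearity `t ↦ |t|^{p-2} t` for positive `t`. -/
lemma abs_rpow_sub_two_mul_self {t p : ℝ} (ht : 0 < t) : |t| ^ (p - 2) * t = t ^ (p - 1) := by
  rw [abs_of_pos ht, ← Real.rpow_add_one ht.ne']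
  ring_nf

lemma abs_abs_rpow_sub_two_mul_self {t p : ℝ} (hp : 1 < p) :
    |(|t| ^ (p - 2) * t)| = |t| ^ (p - 1) := by
  rw [abs_mul, abs_of_nonneg (Real.rpow_nonneg (abs_nonneg t) _)]
  rcases (abs_nonneg t).eq_or_lt with h | h
  · rw [← h, mul_zero, Real.zero_rpow (by linarith)]
  · rw [← Real.rpow_add_one h.ne']; ring_nf

lemma pow_sub_pow_le_mul {a b : ℝ} {m : ℕ} (ha : 0 ≤ a) (hab : a ≤ b) (hm : 1 ≤ m) :
    b ^ m - a ^ m ≤ m * b ^ (m - 1) * (b - a) := by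
  obtain ⟨l, rfl⟩ : ∃ l, m = l + 1 := ⟨m - 1, by omega⟩
  simp only [Nat.add_sub_cancel]
  have hb : 0 ≤ b := ha.trans hab
  clear hm
  induction l with
  | zero => simp
  | succ l ih =>
    have h1 : b ^ (l + 1 + 1) - a ^ (l + 1 + 1)
        = b * (b ^ (l + 1) - a ^ (l + 1)) + a ^ (l + 1) * (b - a) := by ring
    have h2 : a ^ (l + 1) ≤ b ^ (l + 1) := pow_le_pow_left₀ ha hab _
    have h3 := mul_le_mul_of_nonneg_left ih hb
    have h4 := mul_le_mul_of_nonneg_right h2 (sub_nonneg.2 hab)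
    rw [h1]
    push_cast at h3 ⊢
    calc _ ≤ b * ((l + 1) * b ^ l * (b - a)) + b ^ (l + 1) * (b - a) := by linarith
      _ = _ := by ring

lemma abs_pow_sub_pow_le {a b : ℝ} {m : ℕ} (ha : 0 ≤ a) (hb : 0 ≤ b) (ha1 : a ≤ 1) (hb1 : b ≤ 1)
    (hm : 1 ≤ m) : |a ^ m - b ^ m| ≤ m * |a - b| := by
  have key : ∀ c e : ℝ, 0 ≤ c → c ≤ e → e ≤ 1 → |e ^ m - c ^ m| ≤ m * |e - c| := by
    intro c e hc hce he
    rw [abs_of_nonneg (sub_nonneg.2 (pow_le_pow_left₀ hc hce _)),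
      abs_of_nonneg (sub_nonneg.2 hce)]
    refine (pow_sub_pow_le_mul hc hce hm).trans ?_
    have : e ^ (m - 1) ≤ 1 := pow_le_one₀ (hc.trans hce) he
    have h0 : (0 : ℝ) ≤ m * (e - c) := mul_nonneg (by positivity) (sub_nonneg.2 hce)
    nlinarith
  rcases le_total a b with h | h
  · rw [abs_sub_comm, abs_sub_comm a b]; exact key a b ha h hb1
  · exact key b a hb h ha1

/-- If only `U` exceeds the level, `U - V ≥ a` and the product is already coercive. If both do, `U -
V = a - b`, and the only loss occurs when the cutoff is larger at the smaller value; that loss is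
split by Young's inequality. -/
lemma caccioppoli_pointwise_of_lt {U V k p e f : ℝ} {m : ℕ} (hp : 1 < p) (hm : p ≤ m) (hUV : V < U)
    (he : 0 ≤ e) (hf : 0 ≤ f) (hf1 : f ≤ 1) :
    1 / 2 * |max (U - k) 0 - max (V - k) 0| ^ p * min e f ^ m
      - (2 * m) ^ p * max (max (U - k) 0) (max (V - k) 0) ^ p * |e - f| ^ p
      ≤ |U - V| ^ (p - 2) * (U - V) * (max (U - k) 0 * e ^ m - max (V - k) 0 * f ^ m) := by
  have hm1 : 1 ≤ m := by
    have : (1 : ℝ) < m := lt_of_lt_of_le hp hm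
    exact_mod_cast this.le
  rw [abs_rpow_sub_two_mul_self (sub_pos.2 hUV)]
  set a := max (U - k) 0 with ha
  set b := max (V - k) 0 with hb
  have ha0 : 0 ≤ a := le_max_right _ _
  have hb0 : 0 ≤ b := le_max_right _ _
  have hba : b ≤ a := max_le_max (by linarith) le_rfl
  have herr : 0 ≤ (2 * m : ℝ) ^ p * max a b ^ p * |e - f| ^ p := by positivity
  have hmin0 : 0 ≤ min e f := le_min he hf
  rw [abs_of_nonneg (sub_nonneg.2 hba)]
  have hmul : ∀ t : ℝ, 0 ≤ t → t ^ (p - 1) * t = t ^ p := by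
    intro t ht
    rcases ht.eq_or_lt with rfl | ht'
    · rw [mul_zero, Real.zero_rpow (by linarith)]
    · rw [← Real.rpow_add_one ht'.ne']; ring_nf
  rcases le_or_gt k V with hkV | hkV
  · -- both values above the level
    have hD : U - V = a - b := by
      rw [ha, hb, max_eq_left (by linarith), max_eq_left (by linarith)]; ring
    have hD0 : 0 < a - b := by linarith
    rw [hD]
    set D := a - b with hDdef
    have hDp : 0 ≤ D ^ (p - 1) := by positivity
    rcases le_or_gt f e with hfe | hfe
    · rw [min_eq_right hfe]
      have h1 : f ^ m ≤ e ^ m := pow_le_pow_left₀ hf hfe _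
      have h2 : D * f ^ m ≤ a * e ^ m - b * f ^ m := by
        have := mul_le_mul_of_nonneg_left h1 ha0
        rw [hDdef, sub_mul]; linarith
      have h3 := mul_le_mul_of_nonneg_left h2 hDp
      rw [← mul_assoc, hmul D hD0.le] at h3
      have : 0 ≤ D ^ p * f ^ m := by positivity
      linarith
    · rw [min_eq_left hfe.le, max_eq_left hba, abs_sub_comm, abs_of_pos (sub_pos.2 hfe)] at *
      have h1 : f ^ m - e ^ m ≤ m * f ^ (m - 1) * (f - e) := pow_sub_pow_le_mul he hfe.le hm1
      have h2 : e ^ m ≤ f ^ m := pow_le_pow_left₀ he hfe.le _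
      have hff : f ^ (m - 1) * f = f ^ m := by
        rw [← pow_succ]; congr 1; omega
      have h4 : D ^ (p - 1) * (a * e ^ m - b * f ^ m)
          = D ^ p * f ^ m - D ^ (p - 1) * (a * (f ^ m - e ^ m)) := by
        rw [← hmul D hD0.le, hDdef]; ring
      rw [h4]
      have h5 : D ^ (p - 1) * (a * (f ^ m - e ^ m))
          ≤ D ^ (p - 1) * (a * (m * f ^ (m - 1) * (f - e))) :=
        mul_le_mul_of_nonneg_left (mul_le_mul_of_nonneg_left h1 ha0) hDp
      have h6 : D ^ p * e ^ m ≤ D ^ p * f ^ m := mul_le_mul_of_nonneg_left h2 (by positivity)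
      have hfe0 : 0 < f - e := sub_pos.2 hfe
      suffices h7 : D ^ (p - 1) * (a * (m * f ^ (m - 1) * (f - e)))
          ≤ 1 / 2 * (D ^ p * f ^ m) + (2 * m) ^ p * a ^ p * (f - e) ^ p by linarith
      -- Young's inequality by cases: either the cutoff increment is small against `D * f` and half
      -- of `D ^ p * f ^ m` absorbs the loss, or `D * f` is itself bounded by the increment.
      rcases le_or_gt (2 * (m * a * (f - e))) (D * f) with hc | hc
      · have h8 : D ^ (p - 1) * f ^ (m - 1) * (2 * (m * a * (f - e)))
            ≤ D ^ (p - 1) * f ^ (m - 1) * (D * f) :=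
          mul_le_mul_of_nonneg_left hc (by positivity)
        have h9 : D ^ (p - 1) * f ^ (m - 1) * (D * f) = D ^ p * f ^ m := by
          rw [← hff, ← hmul D hD0.le]; ring
        have h10 : 0 ≤ (2 * m : ℝ) ^ p * a ^ p * (f - e) ^ p := by positivity
        linarith
      · have hf0 : 0 < f := lt_of_le_of_lt he hfe
        have hx0 : (0 : ℝ) ≤ 2 * (m * a * (f - e)) := by positivity
        -- The reason for taking the power `m ≥ p` of the cutoff: since `f ≤ 1`, enough powers of
        -- `f` remain to accompany `D ^ (p - 1)`.
        have h8 : f ^ (m - 1) ≤ f ^ (p - 1) := by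
          rw [← Real.rpow_natCast]
          apply Real.rpow_le_rpow_of_exponent_ge hf0 hf1
          rw [Nat.cast_sub hm1]; push_cast; linarith
        have h9 : (D * f) ^ (p - 1) ≤ (2 * (m * a * (f - e))) ^ (p - 1) :=
          Real.rpow_le_rpow (by positivity) hc.le (by linarith)
        rw [Real.mul_rpow hD0.le hf] at h9
        have h10 : D ^ (p - 1) * f ^ (m - 1) * (2 * (m * a * (f - e)))
            ≤ (2 * (m * a * (f - e))) ^ p := by
          rw [← hmul _ hx0]
          apply mul_le_mul_of_nonneg_right _ hx0
          exact (mul_le_mul_of_nonneg_left h8 hDp).trans h9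
        have h11 : (2 * (m * a * (f - e))) ^ p = (2 * m) ^ p * a ^ p * (f - e) ^ p := by
          rw [← Real.mul_rpow (by positivity) ha0, ← Real.mul_rpow (by positivity) hfe0.le]
          ring_nf
        have h12 : 0 ≤ D ^ p * f ^ m := by positivity
        have h13 : 0 ≤ (2 * m : ℝ) ^ p * a ^ p * (f - e) ^ p := by positivity
        rw [h11] at h10
        linarith
  · have hb' : b = 0 := max_eq_right (by linarith)
    rw [hb', zero_mul, sub_zero, sub_zero]
    rw [hb'] at herr
    have h1 : min e f ^ m ≤ e ^ m := pow_le_pow_left₀ hmin0 (min_le_left _ _) _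
    have h2 : a ^ (p - 1) * (a * e ^ m) ≤ (U - V) ^ (p - 1) * (a * e ^ m) := by
      apply mul_le_mul_of_nonneg_right _ (by positivity)
      apply Real.rpow_le_rpow ha0 _ (by linarith)
      exact max_le (by linarith) (by linarith)
    rw [← mul_assoc, hmul a ha0] at h2
    have h3 : a ^ p * min e f ^ m ≤ a ^ p * e ^ m := mul_le_mul_of_nonneg_left h1 (by positivity)
    have h4 : 0 ≤ a ^ p * min e f ^ m := by positivity
    linarith

/-- The algebraic inequality behind the Caccioppoli estimate. -/
lemma caccioppoli_pointwise {U V k p e f : ℝ} {m : ℕ} (hp : 1 < p) (hm : p ≤ m)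
    (he : 0 ≤ e) (he1 : e ≤ 1) (hf : 0 ≤ f) (hf1 : f ≤ 1) :
    1 / 2 * |max (U - k) 0 - max (V - k) 0| ^ p * min e f ^ m
      - (2 * m) ^ p * max (max (U - k) 0) (max (V - k) 0) ^ p * |e - f| ^ p
      ≤ |U - V| ^ (p - 2) * (U - V) * (max (U - k) 0 * e ^ m - max (V - k) 0 * f ^ m) := by
  rcases lt_trichotomy U V with h | h | h
  · have := caccioppoli_pointwise_of_lt (k := k) hp hm h hf he he1
    rw [abs_sub_comm (max (U - k) 0), abs_sub_comm U, abs_sub_comm e, min_comm,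
      max_comm (max (U - k) 0)]
    refine this.trans (le_of_eq ?_)
    ring
  · subst h
    have : 0 ≤ (2 * m : ℝ) ^ p * max (max (U - k) 0) (max (U - k) 0) ^ p * |e - f| ^ p := by
      have : 0 ≤ max (U - k) 0 := le_max_right _ _
      rw [max_self]
      positivity
    simp only [sub_self, abs_zero, mul_zero, zero_mul]
    rw [Real.zero_rpow (by linarith)]
    linarith
  · exact caccioppoli_pointwise_of_lt hp hm h he hf hf1

/-- Lower bound for the interaction with points outside the support of the test function. -/
lemma neg_le_nonlinearity_mul {U V k p c : ℝ} (hp : 1 < p) (hk : 0 ≤ k) (hc : 0 ≤ c)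
    (hck : c ≤ max (U - k) 0) :
    -(|V| ^ (p - 1) * max (U - k) 0) ≤ |U - V| ^ (p - 2) * (U - V) * c := by
  have ha : 0 ≤ max (U - k) 0 := le_max_right _ _
  have h0 : 0 ≤ |V| ^ (p - 1) * max (U - k) 0 := by positivity
  rcases le_or_gt V U with h | h
  · have : 0 ≤ |U - V| ^ (p - 2) * (U - V) * c :=
      mul_nonneg (mul_nonneg (by positivity) (sub_nonneg.2 h)) hc
    linarith
  · rcases le_or_gt U k with hU | hU
    · have hz : max (U - k) 0 = 0 := max_eq_right (by linarith)
      have : c = 0 := le_antisymm (hz ▸ hck) hc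
      rw [hz, this]; simp
    · have h1 : |U - V| ^ (p - 2) * (U - V) = -(V - U) ^ (p - 1) := by
        rw [← abs_rpow_sub_two_mul_self (sub_pos.2 h), abs_sub_comm]; ring
      rw [h1, neg_mul, neg_le_neg_iff]
      apply mul_le_mul _ hck hc (by positivity)
      -- Here `0 ≤ k < U < V`, so `V - U ≤ |V|`.
      apply Real.rpow_le_rpow (by linarith) _ (by linarith)
      rw [abs_of_pos (by linarith)]
      linarith

/-! ### A comparison kernel -/

/-- Radial profile of an integrable kernel dominating the truncated fractional kernels. -/
noncomputable def kerProfile (n : ℕ) (τ d : ℝ) : ℝ :=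
  if d < 1 then d ^ (τ - n) else d ^ (-((n : ℝ) + τ))

lemma kerProfile_nonneg {n : ℕ} {τ d : ℝ} (hd : 0 ≤ d) : 0 ≤ kerProfile n τ d := by
  unfold kerProfile; split_ifs <;> positivity

lemma measurable_kerProfile {n : ℕ} {τ : ℝ} : Measurable (kerProfile n τ) :=
  Measurable.ite measurableSet_Iio (by fun_prop) (by fun_prop)

/-- For `d < 1` the quotient is `d ^ (p * (1 - s) - n)` with `p * (1 - s) ≥ τ`; for `d ≥ 1` it
decays with exponent `n + s * p ≥ n + τ`. One integrable kernel therefore serves all values of `s`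
and `p`. -/
lemma min_rpow_div_le_kerProfile {n : ℕ} {τ d s p : ℝ} (hd : 0 ≤ d) (hp : 1 < p)
    (hτs : τ ≤ s) (hτs' : τ ≤ 1 - s) (hτ : 0 < τ) :
    (min d 1) ^ p / d ^ ((n : ℝ) + s * p) ≤ kerProfile n τ d := by
  unfold kerProfile
  split_ifs with h
  · rw [min_eq_left h.le]
    rcases hd.eq_or_lt with rfl | hd0
    · rw [Real.zero_rpow (by linarith), zero_div]; positivity
    · rw [← Real.rpow_sub hd0]
      apply Real.rpow_le_rpow_of_exponent_ge hd0 h.le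
      nlinarith
  · push Not at h
    rw [min_eq_right h, Real.one_rpow, one_div, ← Real.rpow_neg hd]
    apply Real.rpow_le_rpow_of_exponent_le h
    nlinarith

lemma lintegral_kerProfile_lt_top {n : ℕ} (hn : 1 ≤ n) {τ : ℝ} (hτ : 0 < τ) :
    ∫⁻ y : Rn n, ENNReal.ofReal (kerProfile n τ ‖y‖) < ∞ := by
  have hfin : Module.finrank ℝ (Rn n) = n := by simp
  rw [← lintegral_add_compl _ (Metric.isOpen_ball (x := (0 : Rn n)) (ε := 1)).measurableSet]
  refine ENNReal.add_lt_top.2 ⟨?_, ?_⟩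
  · have h1 : IntegrableOn (fun y : Rn n => kerProfile n τ ‖y‖) (Metric.ball 0 1) := by
      apply integrableOn_ball_of_norm_le_rpow (C := 1) (α := n - τ) (by rw [hfin]; exact hn)
        (by rw [hfin]; linarith)
      · filter_upwards [ae_restrict_mem Metric.isOpen_ball.measurableSet] with x hx
        rw [mem_ball_zero_iff] at hx
        rw [Real.norm_of_nonneg (kerProfile_nonneg (norm_nonneg _)), kerProfile, if_pos hx]
        rw [one_mul, neg_sub]
      · exact (measurable_kerProfile.comp measurable_norm).aestronglyMeasurable
    exact h1.lintegral_lt_top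
  · have h1 : Integrable (fun y : Rn n => 2 ^ ((n : ℝ) + τ) * (1 + ‖y‖) ^ (-((n : ℝ) + τ))) :=
      (integrable_one_add_norm (by rw [hfin]; linarith)).const_mul _
    refine lt_of_le_of_lt ?_ (h1.integrableOn (s := (Metric.ball (0 : Rn n) 1)ᶜ)).lintegral_lt_top
    apply setLIntegral_mono' Metric.isOpen_ball.measurableSet.compl
    intro y hy
    apply ENNReal.ofReal_le_ofReal
    have hy1 : 1 ≤ ‖y‖ := by simpa using hy
    rw [kerProfile, if_neg (not_lt.2 hy1), Real.rpow_neg (by positivity), Real.rpow_neg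
      (by positivity), ← div_eq_mul_inv, le_div_iff₀ (by positivity), inv_mul_le_iff₀
      (by positivity), ← Real.mul_rpow (by positivity) (by positivity)]
    apply Real.rpow_le_rpow (by positivity) (by linarith)
    positivity

/-- Convolution bound by Tonelli. -/
lemma setLIntegral_prod_univ_kernel_le {n : ℕ} (A : Set (Rn n)) (F : Rn n → ℝ≥0∞)
    {g : Rn n → ℝ≥0∞} (hg : Measurable g) (hg' : ∫⁻ y, g y ≠ ∞) :
    ∫⁻ z in A ×ˢ (Set.univ : Set (Rn n)), F z.1 * g (z.1 - z.2)
      ≤ (∫⁻ x in A, F x) * ∫⁻ y, g y := by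
  rw [Measure.volume_eq_prod, ← Measure.prod_restrict, Measure.restrict_univ,
    ← lintegral_mul_const' _ _ hg']
  refine (lintegral_prod_le _).trans (lintegral_mono fun x => ?_)
  simp only
  calc ∫⁻ y, F x * g (x - y) = ∫⁻ y, (fun t => F x * g t) (x - y) := rfl
    _ = ∫⁻ y, F x * g y := lintegral_sub_left_eq_self (fun t => F x * g t) x
    _ ≤ _ := (lintegral_const_mul _ hg).le

/-! ### Two abstract lemmas -/

/-- Passing to the limit in a family of vanishing integrals that are bounded below. -/
lemma lintegral_le_of_tendsto_of_integral_eq_zero {α : Type*} [MeasurableSpace α] {μ : Measure α}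
    {J : ℕ → α → ℝ} {J' H E P : α → ℝ} (hJ : ∀ M, Integrable (J M) μ)
    (hJ0 : ∀ M, ∫ z, J M z ∂μ = 0) (hlim : ∀ᵐ z ∂μ, Tendsto (fun M => J M z) atTop (𝓝 (J' z)))
    (hH : Integrable H μ) (hJH : ∀ M, ∀ᵐ z ∂μ, -H z ≤ J M z)
    (hE : Integrable E μ) (hE0 : ∀ z, 0 ≤ E z)
    (hP0 : ∀ᵐ z ∂μ, 0 ≤ P z) (hP : ∀ᵐ z ∂μ, P z ≤ J' z + E z) :
    ∫⁻ z, ENNReal.ofReal (P z) ∂μ ≤ ∫⁻ z, ENNReal.ofReal (E z) ∂μ := by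
  have hJ'm : AEStronglyMeasurable J' μ :=
    aestronglyMeasurable_of_tendsto_ae atTop (fun M => (hJ M).aestronglyMeasurable) hlim
  have hJ'H : ∀ᵐ z ∂μ, 0 ≤ J' z + H z := by
    have h1 : ∀ᵐ z ∂μ, ∀ M, -H z ≤ J M z := ae_all_iff.2 hJH
    filter_upwards [h1, hlim] with z hz hl
    have := ge_of_tendsto' hl hz
    linarith
  have hsum : ∀ M, ∫⁻ z, ENNReal.ofReal (J M z + H z) ∂μ = ENNReal.ofReal (∫ z, H z ∂μ) := by
    intro M
    have hi : Integrable (fun z => J M z + H z) μ := (hJ M).add hH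
    rw [← ofReal_integral_eq_lintegral_ofReal hi, integral_add (hJ M) hH, hJ0, zero_add]
    filter_upwards [hJH M] with z hz
    simp only [Pi.zero_apply]
    linarith
  -- Fatou's lemma applies to the nonnegative functions `J M + H`, all of integral `∫ H`. It yields
  -- both the integrability of `J'` and `∫ J' ≤ 0`.
  have hfatou : ∫⁻ z, ENNReal.ofReal (J' z + H z) ∂μ ≤ ENNReal.ofReal (∫ z, H z ∂μ) := by
    calc ∫⁻ z, ENNReal.ofReal (J' z + H z) ∂μ
        = ∫⁻ z, liminf (fun M => ENNReal.ofReal (J M z + H z)) atTop ∂μ := by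
          apply lintegral_congr_ae
          filter_upwards [hlim] with z hz
          exact ((ENNReal.tendsto_ofReal (hz.add_const (H z))).liminf_eq).symm
      _ ≤ liminf (fun M => ∫⁻ z, ENNReal.ofReal (J M z + H z) ∂μ) atTop :=
          lintegral_liminf_le' fun M => ((hJ M).add hH).aemeasurable.ennreal_ofReal
      _ = _ := by simp only [hsum, liminf_const]
  have hJ'Hi : Integrable (fun z => J' z + H z) μ := by
    refine ⟨hJ'm.add hH.aestronglyMeasurable, ?_⟩
    rw [hasFiniteIntegral_iff_ofReal hJ'H]
    exact lt_of_le_of_lt hfatou ENNReal.ofReal_lt_top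
  have hJ'i : Integrable J' μ := by
    have := hJ'Hi.sub hH
    refine this.congr (Eventually.of_forall fun z => ?_)
    simp
  have hint : ∫ z, J' z ∂μ ≤ 0 := by
    rw [← ofReal_integral_eq_lintegral_ofReal hJ'Hi hJ'H, integral_add hJ'i hH] at hfatou
    have hH0 : 0 ≤ ∫ z, H z ∂μ := by
      have := integral_nonneg_of_ae (μ := μ) (f := fun z => J 0 z + H z) (by
        filter_upwards [hJH 0] with z hz
        simp only [Pi.zero_apply]
        linarith)
      rwa [integral_add (hJ 0) hH, hJ0, zero_add] at this
    have := (ENNReal.ofReal_le_ofReal_iff hH0).1 hfatou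
    linarith
  calc ∫⁻ z, ENNReal.ofReal (P z) ∂μ ≤ ∫⁻ z, ENNReal.ofReal (J' z + E z) ∂μ :=
        lintegral_mono_ae (hP.mono fun z hz => ENNReal.ofReal_le_ofReal hz)
    _ = ENNReal.ofReal (∫ z, J' z + E z ∂μ) := by
        have hi : Integrable (fun z => J' z + E z) μ := hJ'i.add hE
        rw [ofReal_integral_eq_lintegral_ofReal hi]
        filter_upwards [hP, hP0] with z hz h0
        exact h0.trans hz
    _ ≤ ENNReal.ofReal (∫ z, E z ∂μ) := by
        rw [integral_add hJ'i hE]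
        exact ENNReal.ofReal_le_ofReal (by linarith)
    _ = _ := ofReal_integral_eq_lintegral_ofReal hE (Eventually.of_forall hE0)

/-- Fast geometric convergence. -/
lemma exists_tendsto_zero_of_iterate_le {C b κ : ℝ} (hC : 0 < C) (hb : 1 < b) (hκ : 1 < κ) :
    ∃ ε : ℝ, 0 < ε ∧ ∀ Y : ℕ → ℝ≥0∞, Y 0 ≤ ENNReal.ofReal ε →
      (∀ j, Y (j + 1) ≤ ENNReal.ofReal (C * b ^ j) * Y j ^ κ) → Tendsto Y atTop (𝓝 0) := by
  have hκ' : 0 < κ - 1 := by linarith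
  have hb0 : 0 < b := by linarith
  -- `θ` and `ε` are chosen so that `ε * θ ^ j` solves the recursion with equality.
  set θ : ℝ := b ^ (-(1 / (κ - 1))) with hθ
  have hθ0 : 0 < θ := by positivity
  have hθ1 : θ < 1 := Real.rpow_lt_one_of_one_lt_of_neg hb (by
    have : 0 < 1 / (κ - 1) := by positivity
    linarith)
  have hθb : θ ^ (κ - 1) = b⁻¹ := by
    rw [hθ, ← Real.rpow_mul hb0.le, neg_mul, one_div, inv_mul_cancel₀ hκ'.ne', Real.rpow_neg_one]
  set ε : ℝ := (θ / C) ^ (1 / (κ - 1)) with hε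
  have hε0 : 0 < ε := by positivity
  have hεC : ε ^ (κ - 1) = θ / C := by
    rw [hε, ← Real.rpow_mul (by positivity), one_div, inv_mul_cancel₀ hκ'.ne', Real.rpow_one]
  refine ⟨ε, hε0, fun Y h0 hY => ?_⟩
  have key : ∀ j, Y j ≤ ENNReal.ofReal (ε * θ ^ j) := by
    intro j
    induction j with
    | zero => simpa using h0
    | succ j ih =>
      refine (hY j).trans ?_
      have h1 : Y j ^ κ ≤ ENNReal.ofReal ((ε * θ ^ j) ^ κ) := by
        rw [← ENNReal.ofReal_rpow_of_pos (by positivity)]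
        exact ENNReal.rpow_le_rpow ih (by linarith)
      refine (mul_le_mul' le_rfl h1).trans ?_
      rw [← ENNReal.ofReal_mul (by positivity)]
      apply ENNReal.ofReal_le_ofReal
      have h2 : (ε * θ ^ j) ^ κ = (ε * θ ^ j) * ((θ / C) * (b⁻¹) ^ j) := by
        have h3 : (ε * θ ^ j) ^ κ = (ε * θ ^ j) ^ (1 + (κ - 1)) := by ring_nf
        rw [h3, Real.rpow_add (by positivity), Real.rpow_one, Real.mul_rpow hε0.le (by positivity),
          hεC, ← Real.rpow_natCast θ, ← Real.rpow_mul hθ0.le, mul_comm (j : ℝ), Real.rpow_mul hθ0.le,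
          hθb, Real.rpow_natCast, Real.rpow_natCast]
      rw [h2, inv_pow]
      apply le_of_eq
      field_simp
      rw [pow_succ]
  have h2 : Tendsto (fun j => ENNReal.ofReal (ε * θ ^ j)) atTop (𝓝 0) := by
    rw [← ENNReal.ofReal_zero]
    apply ENNReal.tendsto_ofReal
    simpa using (tendsto_pow_atTop_nhds_zero_of_lt_one hθ0.le hθ1).const_mul ε
  exact tendsto_of_tendsto_of_tendsto_of_le_of_le tendsto_const_nhds h2 (fun _ => zero_le) key

/-! ### A local fractional Sobolev inequality -/

/-- The integrand of the variable exponent Gagliardo energy. -/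
noncomputable def energyDensity {n : ℕ} (s p : Rn n → Rn n → ℝ) (v : Rn n → ℝ)
    (z : Rn n × Rn n) : ℝ :=
  |v z.1 - v z.2| ^ p z.1 z.2 / ‖z.1 - z.2‖ ^ ((n : ℝ) + s z.1 z.2 * p z.1 z.2)

lemma energyDensity_nonneg {n : ℕ} {s p : Rn n → Rn n → ℝ} {v : Rn n → ℝ} (z : Rn n × Rn n) :
    0 ≤ energyDensity s p v z := by
  unfold energyDensity; positivity

lemma aemeasurable_dist_rpow {n : ℕ} {s p : Rn n → Rn n → ℝ}
    (hs : LebesgueMeasurable₂ s) (hp : LebesgueMeasurable₂ p) :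
    AEMeasurable (fun z : Rn n × Rn n => ‖z.1 - z.2‖ ^ ((n : ℝ) + s z.1 z.2 * p z.1 z.2))
      volume := by
  have h1 : AEMeasurable (fun z : Rn n × Rn n => ‖z.1 - z.2‖) volume := by fun_prop
  exact h1.pow ((hs.mul hp).const_add _)

lemma aemeasurable_comp_fst {n : ℕ} {v : Rn n → ℝ} (hv : AEMeasurable v volume) :
    AEMeasurable (fun z : Rn n × Rn n => v z.1) volume :=
  hv.comp_quasiMeasurePreserving Measure.quasiMeasurePreserving_fst

lemma aemeasurable_comp_snd {n : ℕ} {v : Rn n → ℝ} (hv : AEMeasurable v volume) :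
    AEMeasurable (fun z : Rn n × Rn n => v z.2) volume :=
  hv.comp_quasiMeasurePreserving Measure.quasiMeasurePreserving_snd

lemma aemeasurable_abs_sub {n : ℕ} {v : Rn n → ℝ} (hv : AEMeasurable v volume) :
    AEMeasurable (fun z : Rn n × Rn n => |v z.1 - v z.2|) volume :=
  (aemeasurable_comp_fst hv).sub (aemeasurable_comp_snd hv) |>.abs

lemma aemeasurable_energyDensity {n : ℕ} {s p : Rn n → Rn n → ℝ} {v : Rn n → ℝ}
    (hs : LebesgueMeasurable₂ s) (hp : LebesgueMeasurable₂ p) (hv : AEMeasurable v volume) :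
    AEMeasurable (energyDensity s p v) volume :=
  ((aemeasurable_abs_sub hv).pow hp).div (aemeasurable_dist_rpow hs hp)

/-- Trades the variable power `p` for the constant `q`. If the difference quotient `|v x - v y| / d
^ s` is at least `1`, raising its exponent from `q` to `p` only increases it; otherwise the
difference is below `d ^ s`, which gives the additive term. As `d ≤ t ≤ 1`, `s` may be replaced by
`s₀` and `d` by `t`. -/
lemma abs_sub_rpow_le_energyDensity {n : ℕ} {s p : Rn n → Rn n → ℝ} {v : Rn n → ℝ} {s₀ q t : ℝ}
    (hs₀ : 0 < s₀) (hs : ∀ x y, s₀ ≤ s x y) (hq : 1 ≤ q) {x y : Rn n} (hqp : q ≤ p x y)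
    (hxy : ‖x - y‖ ≤ t) (ht : t ≤ 1) :
    |v x - v y| ^ q ≤ t ^ ((n : ℝ) + s₀ * q) * energyDensity s p v (x, y) + t ^ (s₀ * q) := by
  have hΦ := energyDensity_nonneg (s := s) (p := p) (v := v) (x, y)
  have ht0 : 0 ≤ t := (norm_nonneg _).trans hxy
  rcases (norm_nonneg (x - y)).eq_or_lt with h0 | hd
  · have : x = y := by rw [← sub_eq_zero, ← norm_eq_zero, ← h0]
    subst this
    rw [sub_self, abs_zero, Real.zero_rpow (by linarith)]
    positivity
  · set d := ‖x - y‖ with hdd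
    have hd1 : d ≤ 1 := hxy.trans ht
    have hsq : s₀ * q ≤ s x y * q := mul_le_mul_of_nonneg_right (hs x y) (by linarith)
    set a := |v x - v y| with ha
    have ha0 : 0 ≤ a := abs_nonneg _
    rcases le_or_gt (d ^ s x y) a with h | h
    · have h1 : 1 ≤ a / d ^ s x y := by rwa [le_div_iff₀ (by positivity), one_mul]
      have h2 := Real.rpow_le_rpow_of_exponent_le h1 hqp
      rw [Real.div_rpow ha0 (by positivity), Real.div_rpow ha0 (by positivity),
        ← Real.rpow_mul hd.le, ← Real.rpow_mul hd.le, div_le_iff₀ (by positivity)] at h2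
      have h3 : a ^ p x y / d ^ (s x y * p x y) * d ^ (s x y * q)
          = d ^ ((n : ℝ) + s x y * q) * energyDensity s p v (x, y) := by
        simp only [energyDensity, ← hdd, ← ha]
        rw [Real.rpow_add hd, Real.rpow_add hd]
        field_simp
      rw [h3] at h2
      have h4 : d ^ ((n : ℝ) + s x y * q) ≤ t ^ ((n : ℝ) + s₀ * q) := by
        refine (Real.rpow_le_rpow_of_exponent_ge hd hd1 ?_).trans
          (Real.rpow_le_rpow hd.le hxy (by positivity))
        linarith
      have h5 := mul_le_mul_of_nonneg_right h4 hΦ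
      have h6 : 0 ≤ t ^ (s₀ * q) := by positivity
      linarith
    · have h1 : a ^ q ≤ (d ^ s x y) ^ q := Real.rpow_le_rpow ha0 h.le (by linarith)
      rw [← Real.rpow_mul hd.le] at h1
      have h4 : d ^ (s x y * q) ≤ t ^ (s₀ * q) :=
        (Real.rpow_le_rpow_of_exponent_ge hd hd1 hsq).trans
          (Real.rpow_le_rpow hd.le hxy (by positivity))
      have h5 : 0 ≤ t ^ ((n : ℝ) + s₀ * q) * energyDensity s p v (x, y) := by positivity
      linarith

/-- Optimising the radius in a mean value estimate. -/
lemma rpow_le_of_forall_radius {F A c e N δ ν γ : ℝ} (hF : 0 ≤ F) (hA : 0 < A) (hc : 0 < c)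
    (he : 0 ≤ e) (hN : 0 < N) (hδ : 0 < δ) (hν : 0 < ν) (hγ : 0 < γ)
    (h : ∀ t, 0 < t → t ≤ δ → F * (c * t ^ ν) ≤ A * (t ^ (ν + γ) * (e + c) + N)) :
    F ^ (1 + γ / ν) ≤
      (2 * A / c) ^ (1 + γ / ν) * N ^ (γ / ν) * (e + c + N * δ ^ (-(ν + γ))) := by
  set G := e + c + N * δ ^ (-(ν + γ)) with hG
  have hG0 : 0 < G := by positivity
  -- This radius balances the two terms: `t ^ (ν + γ) * G = N`. The last summand of `G` is there
  -- only to force `t ≤ δ`.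
  set t := (N / G) ^ (1 / (ν + γ)) with ht
  have ht0 : 0 < t := by positivity
  have htG : t ^ (ν + γ) = N / G := by
    rw [ht, ← Real.rpow_mul (by positivity), one_div, inv_mul_cancel₀ (by positivity),
      Real.rpow_one]
  have htδ : t ≤ δ := by
    rw [← Real.rpow_le_rpow_iff (z := ν + γ) ht0.le hδ.le (by positivity), htG,
      div_le_iff₀ hG0]
    have h1 : δ ^ (ν + γ) * (N * δ ^ (-(ν + γ))) = N := by
      rw [Real.rpow_neg hδ.le]; field_simp
    have h2 : 0 ≤ δ ^ (ν + γ) * (e + c) := by positivity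
    rw [hG, mul_add, h1]; linarith
  have h1 := h t ht0 htδ
  have h2 : t ^ (ν + γ) * (e + c) ≤ N := by
    rw [htG, div_mul_eq_mul_div, div_le_iff₀ hG0]
    apply mul_le_mul_of_nonneg_left _ hN.le
    rw [hG]
    have : 0 ≤ N * δ ^ (-(ν + γ)) := by positivity
    linarith
  have h3 : F ≤ 2 * A / c * (N * (t ^ ν)⁻¹) := by
    have h4 : F * (c * t ^ ν) ≤ A * (2 * N) :=
      h1.trans (mul_le_mul_of_nonneg_left (by linarith) hA.le)
    rw [← le_div_iff₀ (by positivity)] at h4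
    refine h4.trans (le_of_eq ?_)
    field_simp
  have h5 := Real.rpow_le_rpow hF h3 (z := 1 + γ / ν) (by positivity)
  rw [Real.mul_rpow (by positivity) (by positivity), Real.mul_rpow hN.le (by positivity)] at h5
  refine h5.trans (le_of_eq ?_)
  have h6 : ((t ^ ν)⁻¹) ^ (1 + γ / ν) = G / N := by
    rw [Real.inv_rpow (by positivity), ← Real.rpow_mul ht0.le,
      show ν * (1 + γ / ν) = ν + γ by field_simp, htG, inv_div]
  rw [h6, Real.rpow_add hN, Real.rpow_one]
  field_simp

/-- Mean value estimate over a ball of radius `t`. -/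
lemma ofReal_rpow_mul_volume_ball_le {n : ℕ} {s p : Rn n → Rn n → ℝ} {f : Rn n → ℝ} {s₀ q t : ℝ}
    (hs₀ : 0 < s₀) (hs : ∀ x y, s₀ ≤ s x y) (hq : 1 ≤ q) {x : Rn n} {D : Set (Rn n)}
    (hD : Metric.ball x t ⊆ D) (hqp : ∀ y ∈ D, q ≤ p x y)
    (ht : t ≤ 1) (ht0 : 0 < t) (hf : ∀ x, 0 ≤ f x) (hfm : AEMeasurable f volume) :
    ENNReal.ofReal (f x ^ q) * volume (Metric.ball x t) ≤ ENNReal.ofReal (2 ^ q) *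
      (ENNReal.ofReal (t ^ ((n : ℝ) + s₀ * q)) * (∫⁻ y in D, ENNReal.ofReal
        (energyDensity s p f (x, y))) + ENNReal.ofReal (t ^ (s₀ * q)) * volume (Metric.ball x t)
        + ∫⁻ y in D, ENNReal.ofReal (f y ^ q)) := by
  rw [← setLIntegral_const]
  calc ∫⁻ _ in Metric.ball x t, ENNReal.ofReal (f x ^ q)
      ≤ ∫⁻ y in Metric.ball x t, ENNReal.ofReal (2 ^ q) *
          (ENNReal.ofReal (t ^ ((n : ℝ) + s₀ * q)) * ENNReal.ofReal (energyDensity s p f (x, y))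
            + ENNReal.ofReal (t ^ (s₀ * q)) + ENNReal.ofReal (f y ^ q)) := by
        apply setLIntegral_mono' Metric.isOpen_ball.measurableSet
        intro y hy
        have hΦ := energyDensity_nonneg (s := s) (p := p) (v := f) (x, y)
        have hfy := hf y
        rw [← ENNReal.ofReal_mul (by positivity), ← ENNReal.ofReal_add (by positivity)
          (by positivity), ← ENNReal.ofReal_add (by positivity) (by positivity),
          ← ENNReal.ofReal_mul (by positivity)]
        apply ENNReal.ofReal_le_ofReal
        have hxy : ‖x - y‖ ≤ t := by
          rw [← dist_eq_norm, dist_comm]; exact (Metric.mem_ball.1 hy).le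
        have h1 := abs_sub_rpow_le_energyDensity (v := f) hs₀ hs hq (hqp y (hD hy)) hxy ht
        have h2 : f x ^ q ≤ (|f x - f y| + f y) ^ q := by
          apply Real.rpow_le_rpow (hf x) _ (by linarith)
          have := le_abs_self (f x - f y)
          linarith
        refine (h2.trans (add_rpow_le (abs_nonneg _) (hf y) (by linarith))).trans ?_
        apply mul_le_mul_of_nonneg_left _ (by positivity)
        linarith
    _ ≤ _ := by
        rw [lintegral_const_mul' _ _ ENNReal.ofReal_ne_top]
        gcongr
        rw [lintegral_add_right' _ (hfm.pow_const q).ennreal_ofReal.restrict,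
          lintegral_add_right _ measurable_const, setLIntegral_const,
          lintegral_const_mul' _ _ ENNReal.ofReal_ne_top]
        gcongr

/-- A local fractional Sobolev inequality for the variable exponent energy, in interpolated form. -/
lemma exists_lintegral_rpow_le_energy {n : ℕ} (hn : 1 ≤ n) {s p : Rn n → Rn n → ℝ}
    (hsm : LebesgueMeasurable₂ s) (hpm : LebesgueMeasurable₂ p) {s₀ q : ℝ} (hs₀ : 0 < s₀)
    (hs : ∀ x y, s₀ ≤ s x y) (hq : 1 ≤ q) :
    ∃ C : ℝ, 0 < C ∧ ∀ (x₀ : Rn n) (r ρ : ℝ), 0 < r → r < ρ → ρ ≤ 1 →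
      (∀ x ∈ Metric.ball x₀ ρ, ∀ y ∈ Metric.ball x₀ ρ, q ≤ p x y) →
      ∀ f : Rn n → ℝ, (∀ x, 0 ≤ f x) → AEMeasurable f volume →
      (∫⁻ y in Metric.ball x₀ ρ, ENNReal.ofReal (f y ^ q)) ≠ ∞ →
      ∫⁻ x in Metric.ball x₀ r, ENNReal.ofReal (f x ^ (q * (1 + s₀ * q / n))) ≤
        ENNReal.ofReal C * (∫⁻ y in Metric.ball x₀ ρ, ENNReal.ofReal (f y ^ q)) ^ (s₀ * q / n) *
        ((∫⁻ z in Metric.ball x₀ ρ ×ˢ Metric.ball x₀ ρ, ENNReal.ofReal (energyDensity s p f z))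
          + (∫⁻ x in Metric.ball x₀ ρ, if f x = 0 then 0 else 1)
          + ENNReal.ofReal ((ρ - r) ^ (-((n : ℝ) + s₀ * q))) *
            ∫⁻ y in Metric.ball x₀ ρ, ENNReal.ofReal (f y ^ q)) := by
  have hnpos : (0 : ℝ) < n := by exact_mod_cast hn
  have hγ : 0 < s₀ * q := by positivity
  have hne : Nonempty (Fin n) := ⟨⟨0, hn⟩⟩
  set c : ℝ := (volume (Metric.ball (0 : Rn n) 1)).toReal with hcdef
  have hcv : volume (Metric.ball (0 : Rn n) 1) = ENNReal.ofReal c :=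
    (ENNReal.ofReal_toReal measure_ball_lt_top.ne).symm
  have hc : 0 < c := ENNReal.toReal_pos (Metric.measure_ball_pos _ _ one_pos).ne'
    measure_ball_lt_top.ne
  have hball : ∀ (x : Rn n) (t : ℝ), 0 ≤ t →
      volume (Metric.ball x t) = ENNReal.ofReal (c * t ^ (n : ℝ)) := by
    intro x t ht
    rw [Measure.addHaar_ball _ _ ht, hcv, ← ENNReal.ofReal_mul (by positivity), mul_comm]
    simp
  set κ : ℝ := 1 + s₀ * q / n with hκ
  set C₁ : ℝ := (2 * 2 ^ q / c) ^ κ with hC₁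
  have hC₁0 : 0 < C₁ := by positivity
  refine ⟨C₁ * (1 + c), by positivity, ?_⟩
  intro x₀ r ρ hr hrρ hρ hqp f hf hfm hN
  set N := ∫⁻ y in Metric.ball x₀ ρ, ENNReal.ofReal (f y ^ q) with hNdef
  have hδ : 0 < ρ - r := by linarith
  have hsub : Metric.ball x₀ r ⊆ Metric.ball x₀ ρ := Metric.ball_subset_ball hrρ.le
  -- The optimal radius requires `N > 0`; if `N = 0`, then `f` vanishes a.e. and the left side is
  -- zero.
  by_cases hN0 : N = 0
  · have h1 : ∀ᵐ y ∂volume.restrict (Metric.ball x₀ ρ), f y = 0 := by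
      rw [hNdef, lintegral_eq_zero_iff' (hfm.pow_const q).ennreal_ofReal.restrict] at hN0
      filter_upwards [hN0] with y hy
      have h2 : f y ^ q ≤ 0 := by simpa using hy
      by_contra h3
      have : 0 < f y := lt_of_le_of_ne (hf y) (Ne.symm h3)
      have : 0 < f y ^ q := by positivity
      linarith
    have h2 : ∀ᵐ y ∂volume.restrict (Metric.ball x₀ r), f y = 0 :=
      ae_restrict_of_ae_restrict_of_subset hsub h1
    have h3 : ∫⁻ x in Metric.ball x₀ r, ENNReal.ofReal (f x ^ (q * κ)) = 0 := by
      rw [lintegral_eq_zero_iff' (hfm.pow_const _).ennreal_ofReal.restrict]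
      filter_upwards [h2] with y hy
      rw [hy, Real.zero_rpow (by positivity)]
      simp
    rw [h3]
    exact zero_le
  set N' := N.toReal with hN'
  have hNN' : N = ENNReal.ofReal N' := (ENNReal.ofReal_toReal hN).symm
  have hN'0 : 0 < N' := ENNReal.toReal_pos hN0 hN
  set e : Rn n → ℝ≥0∞ := fun x =>
    ∫⁻ y in Metric.ball x₀ ρ, ENNReal.ofReal (energyDensity s p f (x, y)) with he
  set δ' : ℝ := (ρ - r) ^ (-((n : ℝ) + s₀ * q)) with hδ'
  have hδ'0 : 0 < δ' := by positivity
  have hpt : ∀ x ∈ Metric.ball x₀ r, ENNReal.ofReal (f x ^ (q * κ)) ≤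
      ENNReal.ofReal C₁ * N ^ (s₀ * q / n) *
        (e x + (ENNReal.ofReal c * (if f x = 0 then 0 else 1) + ENNReal.ofReal δ' * N)) := by
    intro x hx
    -- Zeros of `f` contribute nothing on the left, so the additive constant is charged only to `{f
    -- ≠ 0}`. In the iteration this set is a superlevel set, whose measure is small.
    by_cases hfx : f x = 0
    · rw [hfx, Real.zero_rpow (by positivity)]; simp
    rw [if_neg hfx, mul_one]
    have hNpos : N ^ (s₀ * q / n) ≠ 0 := by
      rw [hNN', ENNReal.ofReal_rpow_of_pos hN'0]
      exact (ENNReal.ofReal_pos.2 (by positivity)).ne'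
    by_cases hex : e x = ∞
    · rw [hex, top_add, ENNReal.mul_top]
      · exact le_top
      · exact mul_ne_zero (ENNReal.ofReal_pos.2 hC₁0).ne' hNpos
    have hex' : e x = ENNReal.ofReal (e x).toReal := (ENNReal.ofReal_toReal hex).symm
    -- With `ν = n` and `γ = s₀ * q`, the exponent `1 + γ / ν` is the Sobolev gain `κ`.
    have hopt := rpow_le_of_forall_radius (F := f x ^ q) (A := 2 ^ q) (c := c) (e := (e x).toReal)
      (N := N') (δ := ρ - r) (ν := n) (γ := s₀ * q) (by have := hf x; positivity) (by positivity)
      hc ENNReal.toReal_nonneg hN'0 hδ hnpos hγ (by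
        intro t ht htδ
        have hsubt : Metric.ball x t ⊆ Metric.ball x₀ ρ := by
          apply Metric.ball_subset_ball'
          have := (Metric.mem_ball.1 hx).le
          linarith
        have h1 := ofReal_rpow_mul_volume_ball_le (p := p) hs₀ hs hq hsubt
          (hqp x (hsub hx)) (by linarith) ht hf hfm
        rw [hball x t ht.le] at h1
        change _ ≤ ENNReal.ofReal (2 ^ q) * (ENNReal.ofReal (t ^ ((n : ℝ) + s₀ * q)) * e x
          + ENNReal.ofReal (t ^ (s₀ * q)) * _ + N) at h1
        have hfx0 := hf x
        rw [hex', hNN', ← ENNReal.ofReal_mul (by positivity), ← ENNReal.ofReal_mul (by positivity),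
          ← ENNReal.ofReal_mul (by positivity), ← ENNReal.ofReal_add (by positivity)
          (by positivity), ← ENNReal.ofReal_add (by positivity) (by positivity),
          ← ENNReal.ofReal_mul (by positivity), ENNReal.ofReal_le_ofReal_iff (by positivity)] at h1
        refine h1.trans (le_of_eq ?_)
        rw [Real.rpow_add ht]
        ring)
    rw [← Real.rpow_mul (hf x)] at hopt
    rw [hex', hNN', ENNReal.ofReal_rpow_of_pos hN'0, ← ENNReal.ofReal_mul (by positivity),
      ← ENNReal.ofReal_mul (by positivity), ← ENNReal.ofReal_add (by positivity) (by positivity),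
      ← ENNReal.ofReal_add (by positivity) (by positivity), ← ENNReal.ofReal_mul (by positivity)]
    apply ENNReal.ofReal_le_ofReal
    refine hopt.trans (le_of_eq ?_)
    rw [hC₁, hδ']
    ring
  have hfac : ENNReal.ofReal C₁ * N ^ (s₀ * q / n) ≠ ∞ :=
    ENNReal.mul_ne_top ENNReal.ofReal_ne_top (ENNReal.rpow_ne_top_of_nonneg (by positivity) hN)
  have hchi : AEMeasurable (fun x => if f x = 0 then (0 : ℝ≥0∞) else 1) volume :=
    (Measurable.ite (measurableSet_singleton (0 : ℝ)) measurable_const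
      measurable_const : Measurable fun t : ℝ => if t = 0 then (0 : ℝ≥0∞) else 1).comp_aemeasurable
      hfm
  have hvol : volume (Metric.ball x₀ r) ≤ ENNReal.ofReal c := by
    rw [hball x₀ r hr.le]
    apply ENNReal.ofReal_le_ofReal
    have : r ^ (n : ℝ) ≤ 1 := Real.rpow_le_one hr.le (by linarith) (by positivity)
    nlinarith
  calc ∫⁻ x in Metric.ball x₀ r, ENNReal.ofReal (f x ^ (q * κ))
      ≤ ∫⁻ x in Metric.ball x₀ r, ENNReal.ofReal C₁ * N ^ (s₀ * q / n) *
        (e x + (ENNReal.ofReal c * (if f x = 0 then 0 else 1) + ENNReal.ofReal δ' * N)) :=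
        setLIntegral_mono' Metric.isOpen_ball.measurableSet hpt
    _ = ENNReal.ofReal C₁ * N ^ (s₀ * q / n) * ((∫⁻ x in Metric.ball x₀ r, e x)
          + (ENNReal.ofReal c * (∫⁻ x in Metric.ball x₀ r, if f x = 0 then 0 else 1) +
            ENNReal.ofReal δ' * N * volume (Metric.ball x₀ r))) := by
        rw [lintegral_const_mul' _ _ hfac, lintegral_add_right', lintegral_add_right _
          measurable_const, setLIntegral_const, lintegral_const_mul' _ _ ENNReal.ofReal_ne_top]
        exact ((hchi.const_mul _).add_const _).restrict
    _ ≤ ENNReal.ofReal C₁ * N ^ (s₀ * q / n) * (ENNReal.ofReal (1 + c) *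
          ((∫⁻ z in Metric.ball x₀ ρ ×ˢ Metric.ball x₀ ρ, ENNReal.ofReal (energyDensity s p f z))
          + (∫⁻ x in Metric.ball x₀ ρ, if f x = 0 then 0 else 1) + ENNReal.ofReal δ' * N)) := by
        gcongr
        have h1 : ∫⁻ x in Metric.ball x₀ r, e x ≤ ∫⁻ z in Metric.ball x₀ ρ ×ˢ Metric.ball x₀ ρ,
            ENNReal.ofReal (energyDensity s p f z) := by
          rw [Measure.volume_eq_prod, setLIntegral_prod]
          · exact lintegral_mono_set hsub
          · exact (aemeasurable_energyDensity hsm hpm hfm).ennreal_ofReal.restrict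
        have h2 : (∫⁻ x in Metric.ball x₀ r, if f x = 0 then (0 : ℝ≥0∞) else 1) ≤
          ∫⁻ x in Metric.ball x₀ ρ, if f x = 0 then 0 else 1 := lintegral_mono_set hsub
        have hc1 : (1 : ℝ≥0∞) ≤ ENNReal.ofReal (1 + c) := by
          rw [← ENNReal.ofReal_one]; exact ENNReal.ofReal_le_ofReal (by linarith)
        have hc2 : ENNReal.ofReal c ≤ ENNReal.ofReal (1 + c) :=
          ENNReal.ofReal_le_ofReal (by linarith)
        rw [mul_add, mul_add, ← add_assoc]
        refine add_le_add (add_le_add ?_ ?_) ?_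
        · exact h1.trans (le_mul_of_one_le_left' hc1)
        · exact mul_le_mul' hc2 h2
        · rw [mul_comm]; exact mul_le_mul' (hvol.trans hc2) le_rfl
    _ = _ := by
        rw [ENNReal.ofReal_mul hC₁0.le]
        ring

/-! ### Structural assumptions -/

/-- The structural assumptions on the data, with explicit constants. -/
structure Admissible {n : ℕ} (s p K : Rn n → Rn n → ℝ) (Λ τ P : ℝ) : Prop where
  s_meas : LebesgueMeasurable₂ s
  p_meas : LebesgueMeasurable₂ p
  K_meas : LebesgueMeasurable₂ K
  s_symm : Symmetric₂ s
  p_symm : Symmetric₂ p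
  τ_pos : 0 < τ
  τ_le : ∀ x y, τ ≤ s x y
  τ_le' : ∀ x y, τ ≤ 1 - s x y
  one_lt_p : ∀ x y, 1 < p x y
  p_le : ∀ x y, p x y ≤ P
  one_lt_Λ : 1 < Λ
  bounds : KernelBounds s p K Λ

/-- The integrand of the weak formulation. -/
noncomputable def weakIntegrand {n : ℕ} (p K : Rn n → Rn n → ℝ) (u φ : Rn n → ℝ)
    (z : Rn n × Rn n) : ℝ :=
  |u z.1 - u z.2| ^ (p z.1 z.2 - 2) * (u z.1 - u z.2) * (φ z.1 - φ z.2) * K z.1 z.2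

section

variable {n : ℕ} {s p K : Rn n → Rn n → ℝ} {Λ τ P : ℝ}

lemma Admissible.one_lt_P (h : Admissible s p K Λ τ P) : 1 < P :=
  (h.one_lt_p 0 0).trans_le (h.p_le 0 0)

lemma Admissible.abs_weakIntegrand_le (h : Admissible s p K Λ τ P) (u φ : Rn n → ℝ) :
    ∀ᵐ z : Rn n × Rn n, |weakIntegrand p K u φ z| ≤
      Λ * (|u z.1 - u z.2| ^ (p z.1 z.2 - 1) * |φ z.1 - φ z.2| /
        ‖z.1 - z.2‖ ^ ((n : ℝ) + s z.1 z.2 * p z.1 z.2)) := by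
  filter_upwards [h.bounds] with z hz
  have hΛ := h.one_lt_Λ
  have hK0 : 0 ≤ K z.1 z.2 := le_trans (by positivity) hz.1
  rw [weakIntegrand, abs_mul, abs_mul, abs_abs_rpow_sub_two_mul_self (h.one_lt_p _ _),
    abs_of_nonneg hK0]
  refine (mul_le_mul_of_nonneg_left hz.2 (by positivity)).trans (le_of_eq ?_)
  ring

lemma Admissible.aemeasurable_weakIntegrand (h : Admissible s p K Λ τ P) {u φ : Rn n → ℝ}
    (hu : AEMeasurable u volume) (hφ : AEMeasurable φ volume) :
    AEMeasurable (weakIntegrand p K u φ) volume := by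
  have h1 := (aemeasurable_comp_fst hu).sub (aemeasurable_comp_snd hu)
  have h2 := (aemeasurable_comp_fst hφ).sub (aemeasurable_comp_snd hφ)
  exact ((((aemeasurable_abs_sub hu).pow (h.p_meas.sub_const 2)).mul h1).mul h2).mul h.K_meas

lemma Admissible.integrable_energyDensity (h : Admissible s p K Λ τ P) {Ω : Set (Rn n)}
    {u : Rn n → ℝ} (hu : MemW s p Ω u) :
    Integrable (energyDensity s p u) (volume.restrict (crossSet Ω)) := by
  refine ⟨(aemeasurable_energyDensity h.s_meas h.p_meas
    hu.aemeasurable).aestronglyMeasurable.restrict, ?_⟩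
  rw [hasFiniteIntegral_iff_ofReal (Eventually.of_forall energyDensity_nonneg)]
  exact hu.energy_lt_top

/-- Young's inequality bounds the integrand by the two energies. Integrability has to be known
separately, since a Bochner integral is zero by convention when the integrand is not integrable. -/
lemma Admissible.integrable_weakIntegrand (h : Admissible s p K Λ τ P) {Ω : Set (Rn n)}
    {u φ : Rn n → ℝ} (hu : MemW s p Ω u) (hφ : MemW s p Ω φ) :
    Integrable (weakIntegrand p K u φ) (volume.restrict (crossSet Ω)) := by
  refine (((h.integrable_energyDensity hu).add (h.integrable_energyDensity hφ)).const_mul Λ).mono'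
    (h.aemeasurable_weakIntegrand hu.aemeasurable
      hφ.aemeasurable).aestronglyMeasurable.restrict ?_
  filter_upwards [ae_restrict_of_ae (h.abs_weakIntegrand_le u φ)] with z hz
  rw [Real.norm_eq_abs]
  refine hz.trans (mul_le_mul_of_nonneg_left ?_ (by linarith [h.one_lt_Λ]))
  simp only [Pi.add_apply, energyDensity]
  rw [← add_div]
  gcongr
  exact rpow_sub_one_mul_le (abs_nonneg _) (abs_nonneg _) (h.one_lt_p _ _)

/-! ### Integrals of the comparison kernel -/

/-- The comparison kernel on pairs of points. -/
noncomputable def compKer (n : ℕ) (τ : ℝ) (z : Rn n × Rn n) : ℝ := kerProfile n τ ‖z.1 - z.2‖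

lemma compKer_nonneg (z : Rn n × Rn n) : 0 ≤ compKer n τ z := kerProfile_nonneg (norm_nonneg _)

lemma measurable_compKer : Measurable (compKer n τ) :=
  measurable_kerProfile.comp (by fun_prop)

lemma Admissible.min_rpow_div_le (h : Admissible s p K Λ τ P) (z : Rn n × Rn n) :
    (min ‖z.1 - z.2‖ 1) ^ p z.1 z.2 / ‖z.1 - z.2‖ ^ ((n : ℝ) + s z.1 z.2 * p z.1 z.2)
      ≤ compKer n τ z :=
  min_rpow_div_le_kerProfile (norm_nonneg _) (h.one_lt_p _ _) (h.τ_le _ _) (h.τ_le' _ _) h.τ_pos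

lemma setLIntegral_fst_mul_compKer_le (hn : 1 ≤ n) (hτ : 0 < τ) (A : Set (Rn n))
    (F : Rn n → ℝ≥0∞) :
    ∫⁻ z in A ×ˢ (Set.univ : Set (Rn n)), F z.1 * ENNReal.ofReal (compKer n τ z)
      ≤ (∫⁻ x in A, F x) * ∫⁻ y : Rn n, ENNReal.ofReal (kerProfile n τ ‖y‖) :=
  setLIntegral_prod_univ_kernel_le A F
    (g := fun y => ENNReal.ofReal (kerProfile n τ ‖y‖))
    (measurable_kerProfile.comp measurable_norm).ennreal_ofReal
    (lintegral_kerProfile_lt_top hn hτ).ne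

lemma setLIntegral_snd_mul_compKer_le (hn : 1 ≤ n) (hτ : 0 < τ) (A : Set (Rn n))
    (F : Rn n → ℝ≥0∞) :
    ∫⁻ z in (Set.univ : Set (Rn n)) ×ˢ A, F z.2 * ENNReal.ofReal (compKer n τ z)
      ≤ (∫⁻ x in A, F x) * ∫⁻ y : Rn n, ENNReal.ofReal (kerProfile n τ ‖y‖) := by
  refine le_trans (le_of_eq ?_) (setLIntegral_fst_mul_compKer_le hn hτ A F)
  rw [Measure.volume_eq_prod, ← Measure.prod_restrict, ← Measure.prod_restrict,
    ← lintegral_prod_swap]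
  congr 1
  ext z
  simp only [compKer, Prod.fst_swap, Prod.snd_swap]
  rw [norm_sub_rev]

lemma crossSet_subset (Ω : Set (Rn n)) :
    crossSet Ω ⊆ (Ω ×ˢ (Set.univ : Set (Rn n))) ∪ ((Set.univ : Set (Rn n)) ×ˢ Ω) := by
  intro z hz
  simp only [crossSet, Set.mem_compl_iff, Set.mem_prod, not_and_or, not_not] at hz
  rcases hz with hz | hz
  · exact Or.inl ⟨hz, trivial⟩
  · exact Or.inr ⟨trivial, hz⟩

lemma setLIntegral_crossSet_compKer_lt_top (hn : 1 ≤ n) (hτ : 0 < τ) {Ω : Set (Rn n)}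
    (hΩb : Bornology.IsBounded Ω) :
    ∫⁻ z in crossSet Ω, ENNReal.ofReal (compKer n τ z) < ∞ := by
  have hK := lintegral_kerProfile_lt_top hn hτ
  have hvol : volume Ω < ∞ := hΩb.measure_lt_top
  refine lt_of_le_of_lt (lintegral_mono_set (crossSet_subset Ω)) ?_
  refine lt_of_le_of_lt (lintegral_union_le _ _ _) (ENNReal.add_lt_top.2 ⟨?_, ?_⟩)
  · have := setLIntegral_fst_mul_compKer_le hn hτ Ω (fun _ => 1)
    simp only [one_mul, setLIntegral_one] at this
    exact lt_of_le_of_lt this (ENNReal.mul_lt_top hvol hK)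
  · have := setLIntegral_snd_mul_compKer_le hn hτ Ω (fun _ => 1)
    simp only [one_mul, setLIntegral_one] at this
    exact lt_of_le_of_lt this (ENNReal.mul_lt_top hvol hK)

/-! ### Cutoff functions -/

/-- A Lipschitz cutoff, equal to `1` on the ball of radius `a` and to `0` outside the ball of
radius `b`. -/
noncomputable def cutoff (x₀ : Rn n) (a b : ℝ) (x : Rn n) : ℝ :=
  max 0 (min 1 ((b - ‖x - x₀‖) / (b - a)))

variable {x₀ x y : Rn n} {a b : ℝ} {m : ℕ}

lemma cutoff_nonneg : 0 ≤ cutoff x₀ a b x := le_max_left _ _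

lemma cutoff_le_one : cutoff x₀ a b x ≤ 1 := max_le zero_le_one (min_le_left _ _)

lemma continuous_cutoff : Continuous (cutoff x₀ a b) := by
  unfold cutoff; fun_prop

lemma cutoff_eq_one (hab : a < b) (hx : x ∈ Metric.ball x₀ a) : cutoff x₀ a b x = 1 := by
  rw [Metric.mem_ball, dist_eq_norm] at hx
  have h1 : 1 ≤ (b - ‖x - x₀‖) / (b - a) := by
    rw [le_div_iff₀ (by linarith)]; linarith
  rw [cutoff, min_eq_left h1, max_eq_right zero_le_one]

lemma cutoff_eq_zero (hab : a < b) (hx : x ∉ Metric.ball x₀ b) : cutoff x₀ a b x = 0 := by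
  rw [Metric.mem_ball, dist_eq_norm, not_lt] at hx
  have h1 : (b - ‖x - x₀‖) / (b - a) ≤ 0 :=
    div_nonpos_of_nonpos_of_nonneg (by linarith) (by linarith)
  exact max_eq_left ((min_le_right _ _).trans h1)

lemma abs_cutoff_sub_le (hab : a < b) :
    |cutoff x₀ a b x - cutoff x₀ a b y| ≤ ‖x - y‖ / (b - a) := by
  have hba : 0 < b - a := by linarith
  unfold cutoff
  refine (abs_max_sub_max_le_max _ _ _ _).trans (max_le ?_ ?_)
  · rw [sub_self, abs_zero]; positivity
  refine (abs_min_sub_min_le_max _ _ _ _).trans (max_le ?_ ?_)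
  · rw [sub_self, abs_zero]; positivity
  rw [← sub_div, abs_div, abs_of_pos hba]
  gcongr
  have h1 := abs_norm_sub_norm_le (y - x₀) (x - x₀)
  rw [sub_sub_sub_cancel_right] at h1
  rw [norm_sub_rev x y]
  refine le_trans (le_of_eq ?_) h1
  congr 1
  ring

/-- The factor `m` is slack; it lets both Caccioppoli bounds below use the same constant. -/
lemma abs_cutoff_sub_le_min (hab : a < b) (hba : b - a ≤ 1) (hm : 1 ≤ m) :
    |cutoff x₀ a b x - cutoff x₀ a b y| ≤ m / (b - a) * min ‖x - y‖ 1 := by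
  have hba0 : 0 < b - a := by linarith
  have hm' : (1 : ℝ) ≤ m := by exact_mod_cast hm
  have hm1 : 1 / (b - a) ≤ m / (b - a) := by gcongr
  have hm2 : 1 ≤ 1 / (b - a) := by rw [le_div_iff₀ hba0]; linarith
  rcases le_total ‖x - y‖ 1 with hd | hd
  · rw [min_eq_left hd]
    refine (abs_cutoff_sub_le hab).trans ?_
    rw [div_eq_mul_one_div, mul_comm]
    gcongr
  · rw [min_eq_right hd, mul_one]
    refine le_trans ?_ (hm2.trans hm1)
    rw [abs_le]
    have h1 := cutoff_nonneg (x₀ := x₀) (a := a) (b := b) (x := x)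
    have h2 := cutoff_nonneg (x₀ := x₀) (a := a) (b := b) (x := y)
    have h3 := cutoff_le_one (x₀ := x₀) (a := a) (b := b) (x := x)
    have h4 := cutoff_le_one (x₀ := x₀) (a := a) (b := b) (x := y)
    constructor <;> linarith

lemma abs_cutoff_pow_sub_le_min (hab : a < b) (hba : b - a ≤ 1) (hm : 1 ≤ m) :
    |cutoff x₀ a b x ^ m - cutoff x₀ a b y ^ m| ≤ m * (m / (b - a)) * min ‖x - y‖ 1 := by
  refine (abs_pow_sub_pow_le cutoff_nonneg cutoff_nonneg cutoff_le_one cutoff_le_one hm).trans ?_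
  rw [mul_assoc]
  gcongr
  exact abs_cutoff_sub_le_min hab hba hm

/-! ### Test functions -/

/-- The truncated test function `min ((u - k)₊, M) η^m`. -/
noncomputable def testFn (u : Rn n → ℝ) (k : ℝ) (x₀ : Rn n) (a b : ℝ) (m : ℕ) (M : ℝ) (x : Rn n) :
    ℝ :=
  min (max (u x - k) 0) M * cutoff x₀ a b x ^ m

variable {u : Rn n → ℝ} {k M : ℝ}

lemma testFn_nonneg (hM : 0 ≤ M) : 0 ≤ testFn u k x₀ a b m M x :=
  mul_nonneg (le_min (le_max_right _ _) hM) (pow_nonneg cutoff_nonneg _)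

lemma testFn_le_left (hM : 0 ≤ M) : testFn u k x₀ a b m M x ≤ max (u x - k) 0 :=
  (mul_le_of_le_one_right (le_min (le_max_right _ _) hM)
    (pow_le_one₀ cutoff_nonneg cutoff_le_one)).trans (min_le_left _ _)

lemma testFn_le_right (hM : 0 ≤ M) : testFn u k x₀ a b m M x ≤ M :=
  (mul_le_of_le_one_right (le_min (le_max_right _ _) hM)
    (pow_le_one₀ cutoff_nonneg cutoff_le_one)).trans (min_le_right _ _)

lemma testFn_eq_zero (hab : a < b) (hm : 1 ≤ m) (hx : x ∉ Metric.ball x₀ b) :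
    testFn u k x₀ a b m M x = 0 := by
  rw [testFn, cutoff_eq_zero hab hx, zero_pow (by omega), mul_zero]

lemma aemeasurable_testFn (hu : AEMeasurable u volume) :
    AEMeasurable (testFn u k x₀ a b m M) volume :=
  (((hu.sub_const k).max aemeasurable_const).min aemeasurable_const).mul
    ((continuous_cutoff.pow m).measurable.aemeasurable)

lemma abs_testFn_sub_le (hM : 0 ≤ M) (hab : a < b) (hba : b - a ≤ 1) (hm : 1 ≤ m) :
    |testFn u k x₀ a b m M x - testFn u k x₀ a b m M y| ≤
      |u x - u y| + min (max (u y - k) 0) M * (m * (m / (b - a)) * min ‖x - y‖ 1) := by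
  set A := min (max (u x - k) 0) M with hA
  set B := min (max (u y - k) 0) M with hB
  set e := cutoff x₀ a b x with he
  set f := cutoff x₀ a b y with hf
  have hB0 : 0 ≤ B := le_min (le_max_right _ _) hM
  have h1 : testFn u k x₀ a b m M x - testFn u k x₀ a b m M y
      = (A - B) * e ^ m + B * (e ^ m - f ^ m) := by
    simp only [testFn, ← hA, ← hB, ← he, ← hf]; ring
  rw [h1]
  refine (abs_add_le _ _).trans (add_le_add ?_ ?_)
  · rw [abs_mul, abs_of_nonneg (pow_nonneg cutoff_nonneg m : 0 ≤ e ^ m)]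
    refine (mul_le_of_le_one_right (abs_nonneg _)
      (pow_le_one₀ cutoff_nonneg cutoff_le_one)).trans ?_
    refine (abs_min_sub_min_le_max _ _ _ _).trans (max_le ?_ ?_)
    · refine (abs_max_sub_max_le_max _ _ _ _).trans (max_le ?_ ?_)
      · rw [sub_sub_sub_cancel_right]
      · simp
    · simp
  · rw [abs_mul, abs_of_nonneg hB0]
    gcongr
    exact abs_cutoff_pow_sub_le_min hab hba hm

/-- The truncation makes this work. The increment of the product is at most `|u x - u y|` plus `M`
times an increment of the cutoff power, and the latter contributes at most a multiple of `compKer`,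
integrable over the cross set of a bounded `Ω`. -/
lemma Admissible.memW_testFn (h : Admissible s p K Λ τ P) (hn : 1 ≤ n) {Ω : Set (Rn n)}
    (hΩb : Bornology.IsBounded Ω) (hu : MemW s p Ω u) (hM : 0 ≤ M) (hab : a < b)
    (hba : b - a ≤ 1) (hm : 1 ≤ m) : MemW s p Ω (testFn u k x₀ a b m M) := by
  have hmeas := aemeasurable_testFn (k := k) (x₀ := x₀) (a := a) (b := b) (m := m) (M := M)
    hu.aemeasurable
  have hba0 : 0 < b - a := by linarith
  have hP := h.one_lt_P
  refine ⟨hmeas, ?_, ?_⟩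
  · have : IsFiniteMeasure (volume.restrict Ω) := ⟨by
      rw [Measure.restrict_apply_univ]; exact hΩb.measure_lt_top⟩
    apply MemLp.of_bound hmeas.aestronglyMeasurable.restrict M
    refine Eventually.of_forall fun x => ?_
    rw [Real.norm_of_nonneg (testFn_nonneg hM)]
    exact testFn_le_right hM
  · set L : ℝ := M * (m * (m / (b - a))) with hL
    have hL0 : 0 ≤ L := by positivity
    have hpt : ∀ z : Rn n × Rn n, energyDensity s p (testFn u k x₀ a b m M) z ≤
        2 ^ P * (energyDensity s p u z + (1 + L) ^ P * compKer n τ z) := by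
      intro z
      have hp1 := h.one_lt_p z.1 z.2
      have hpP := h.p_le z.1 z.2
      have h1 : |testFn u k x₀ a b m M z.1 - testFn u k x₀ a b m M z.2| ≤
          |u z.1 - u z.2| + L * min ‖z.1 - z.2‖ 1 := by
        refine (abs_testFn_sub_le hM hab hba hm).trans ?_
        rw [hL, mul_assoc M]
        gcongr
        exact min_le_right _ _
      have hmin : 0 ≤ min ‖z.1 - z.2‖ 1 := le_min (norm_nonneg _) zero_le_one
      have h2 : |testFn u k x₀ a b m M z.1 - testFn u k x₀ a b m M z.2| ^ p z.1 z.2 ≤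
          2 ^ P * (|u z.1 - u z.2| ^ p z.1 z.2 + (1 + L) ^ P * min ‖z.1 - z.2‖ 1 ^ p z.1 z.2) := by
        refine (Real.rpow_le_rpow (abs_nonneg _) h1 (by linarith)).trans
          ((add_rpow_le (abs_nonneg _) (by positivity) (by linarith)).trans ?_)
        rw [Real.mul_rpow hL0 hmin]
        have h3 : (2 : ℝ) ^ p z.1 z.2 ≤ 2 ^ P :=
          Real.rpow_le_rpow_of_exponent_le (by norm_num) hpP
        have h4 : L ^ p z.1 z.2 ≤ (1 + L) ^ P :=
          (Real.rpow_le_rpow hL0 (by linarith) (by linarith)).trans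
            (Real.rpow_le_rpow_of_exponent_le (by linarith) hpP)
        gcongr
      have h5 := h.min_rpow_div_le z
      calc energyDensity s p (testFn u k x₀ a b m M) z
          ≤ 2 ^ P * (|u z.1 - u z.2| ^ p z.1 z.2
              + (1 + L) ^ P * min ‖z.1 - z.2‖ 1 ^ p z.1 z.2) /
              ‖z.1 - z.2‖ ^ ((n : ℝ) + s z.1 z.2 * p z.1 z.2) := by
            unfold energyDensity
            gcongr
        _ = 2 ^ P * (energyDensity s p u z + (1 + L) ^ P * (min ‖z.1 - z.2‖ 1 ^ p z.1 z.2 /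
              ‖z.1 - z.2‖ ^ ((n : ℝ) + s z.1 z.2 * p z.1 z.2))) := by
            unfold energyDensity; ring
        _ ≤ _ := by gcongr
    have hker : Integrable (compKer n τ) (volume.restrict (crossSet Ω)) := by
      refine ⟨measurable_compKer.aestronglyMeasurable, ?_⟩
      rw [hasFiniteIntegral_iff_ofReal (Eventually.of_forall compKer_nonneg)]
      exact setLIntegral_crossSet_compKer_lt_top hn h.τ_pos hΩb
    have hint := ((h.integrable_energyDensity hu).add (hker.const_mul ((1 + L) ^ P))).const_mul
      (2 ^ P)
    refine lt_of_le_of_lt (lintegral_mono fun z => ENNReal.ofReal_le_ofReal (hpt z)) ?_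
    exact hint.lintegral_lt_top

end

/-! ### The Caccioppoli estimate -/

section

variable {n : ℕ} {s p K : Rn n → Rn n → ℝ} {Λ τ P Q : ℝ} {u : Rn n → ℝ} {k : ℝ}

/-- The weight `((u - k)₊^Q + 1) 1_{u > k}`. -/
noncomputable def levelWeight (u : Rn n → ℝ) (Q k : ℝ) (x : Rn n) : ℝ :=
  if k < u x then max (u x - k) 0 ^ Q + 1 else 0

lemma levelWeight_nonneg (x : Rn n) : 0 ≤ levelWeight u Q k x := by
  unfold levelWeight
  have : 0 ≤ max (u x - k) 0 := le_max_right _ _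
  split_ifs <;> positivity

lemma aemeasurable_levelWeight (hu : AEMeasurable u volume) :
    AEMeasurable (levelWeight u Q k) volume :=
  (Measurable.ite measurableSet_Ioi (by fun_prop) (by fun_prop) :
    Measurable fun t : ℝ => if k < t then max (t - k) 0 ^ Q + 1 else 0).comp_aemeasurable hu

/-- The purpose of the summand `1`: one weight of constant exponent dominates every power `(u - k)₊
^ p(x,y)` with `p ≤ Q`, and the indicator of `{u > k}` as well. -/
lemma rpow_le_levelWeight {t : ℝ} (ht : 0 < t) (htQ : t ≤ Q) (x : Rn n) :
    max (u x - k) 0 ^ t ≤ levelWeight u Q k x := by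
  unfold levelWeight
  split_ifs with hk
  · exact rpow_le_one_add_rpow (le_max_right _ _) ht.le htQ
  · rw [max_eq_right (by linarith), Real.zero_rpow ht.ne']

lemma le_levelWeight (hQ : 1 ≤ Q) (x : Rn n) : max (u x - k) 0 ≤ levelWeight u Q k x := by
  simpa using rpow_le_levelWeight (u := u) (k := k) one_pos hQ x

lemma levelWeight_le (hQ : 0 ≤ Q) (hk : 0 ≤ k) (x : Rn n) :
    levelWeight u Q k x ≤ |u x| ^ Q + 1 := by
  unfold levelWeight
  split_ifs with h
  · gcongr
    exact max_le (by linarith [le_abs_self (u x)]) (abs_nonneg _)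
  · positivity

/-- The contribution of pairs of nearby points to the error in the Caccioppoli estimate. -/
noncomputable def nearError (τ : ℝ) (u : Rn n → ℝ) (Q k : ℝ) (x₀ : Rn n) (r : ℝ) :
    Rn n × Rn n → ℝ :=
  (Metric.ball x₀ r ×ˢ Metric.ball x₀ r).indicator fun z =>
    (levelWeight u Q k z.1 + levelWeight u Q k z.2) * compKer n τ z

/-- The contribution of pairs of distant points to the error in the Caccioppoli estimate. -/
noncomputable def farError (s p : Rn n → Rn n → ℝ) (u : Rn n → ℝ) (k : ℝ) (x₀ : Rn n) (b r : ℝ) :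
    Rn n × Rn n → ℝ :=
  (Metric.ball x₀ b ×ˢ (Metric.ball x₀ r)ᶜ).indicator fun z =>
    max (u z.1 - k) 0 * (|u z.2| ^ (p z.1 z.2 - 1) /
      ‖z.1 - z.2‖ ^ ((n : ℝ) + s z.1 z.2 * p z.1 z.2))

variable {x₀ : Rn n} {a b r R : ℝ}

lemma nearError_nonneg (z : Rn n × Rn n) : 0 ≤ nearError τ u Q k x₀ r z :=
  Set.indicator_nonneg (fun z _ => mul_nonneg (add_nonneg (levelWeight_nonneg _)
    (levelWeight_nonneg _)) (compKer_nonneg z)) z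

lemma farError_nonneg (z : Rn n × Rn n) : 0 ≤ farError s p u k x₀ b r z :=
  Set.indicator_nonneg (fun z _ => mul_nonneg (le_max_right _ _) (by positivity)) z

lemma aemeasurable_nearError (hu : AEMeasurable u volume) :
    AEMeasurable (nearError τ u Q k x₀ r) volume := by
  refine AEMeasurable.indicator ?_
    (Metric.isOpen_ball.measurableSet.prod Metric.isOpen_ball.measurableSet)
  have h := aemeasurable_levelWeight (Q := Q) (k := k) hu
  exact ((aemeasurable_comp_fst h).add (aemeasurable_comp_snd h)).mul
    measurable_compKer.aemeasurable

lemma Admissible.aemeasurable_farError (h : Admissible s p K Λ τ P) (hu : AEMeasurable u volume) :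
    AEMeasurable (farError s p u k x₀ b r) volume := by
  refine AEMeasurable.indicator ?_
    (Metric.isOpen_ball.measurableSet.prod Metric.isOpen_ball.measurableSet.compl)
  have h1 : AEMeasurable (fun z : Rn n × Rn n => max (u z.1 - k) 0) volume :=
    ((aemeasurable_comp_fst hu).sub_const k).max aemeasurable_const
  exact h1.mul (((aemeasurable_comp_snd hu).abs.pow (h.p_meas.sub_const 1)).div
    (aemeasurable_dist_rpow h.s_meas h.p_meas))

lemma lintegral_nearError_le (hn : 1 ≤ n) (hτ : 0 < τ) (hu : AEMeasurable u volume) :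
    ∫⁻ z, ENNReal.ofReal (nearError τ u Q k x₀ r z) ≤
      2 * (∫⁻ y : Rn n, ENNReal.ofReal (kerProfile n τ ‖y‖)) *
        ∫⁻ x in Metric.ball x₀ r, ENNReal.ofReal (levelWeight u Q k x) := by
  set B := Metric.ball x₀ r with hB
  have hBm : MeasurableSet B := Metric.isOpen_ball.measurableSet
  set V : Rn n → ℝ≥0∞ := fun x => ENNReal.ofReal (levelWeight u Q k x) with hV
  have h1 : ∀ z, ENNReal.ofReal (nearError τ u Q k x₀ r z) =
      (B ×ˢ B).indicator (fun z => V z.1 * ENNReal.ofReal (compKer n τ z)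
        + V z.2 * ENNReal.ofReal (compKer n τ z)) z := by
    intro z
    by_cases hz : z ∈ B ×ˢ B
    · rw [nearError, Set.indicator_of_mem hz, Set.indicator_of_mem hz, add_mul,
        ENNReal.ofReal_add (mul_nonneg (levelWeight_nonneg _) (compKer_nonneg z))
        (mul_nonneg (levelWeight_nonneg _) (compKer_nonneg z)),
        ENNReal.ofReal_mul (levelWeight_nonneg _), ENNReal.ofReal_mul (levelWeight_nonneg _)]
    · rw [nearError, Set.indicator_of_notMem hz, Set.indicator_of_notMem hz, ENNReal.ofReal_zero]
  have hm : AEMeasurable (fun z : Rn n × Rn n => V z.1 * ENNReal.ofReal (compKer n τ z))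
      volume :=
    (aemeasurable_comp_fst (aemeasurable_levelWeight hu)).ennreal_ofReal.mul
      measurable_compKer.ennreal_ofReal.aemeasurable
  rw [lintegral_congr h1, lintegral_indicator (hBm.prod hBm), lintegral_add_left' hm.restrict]
  have h2 : ∫⁻ z in B ×ˢ B, V z.1 * ENNReal.ofReal (compKer n τ z) ≤ _ :=
    (lintegral_mono_set (Set.prod_mono le_rfl (Set.subset_univ _))).trans
      (setLIntegral_fst_mul_compKer_le hn hτ B V)
  have h3 : ∫⁻ z in B ×ˢ B, V z.2 * ENNReal.ofReal (compKer n τ z) ≤ _ :=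
    (lintegral_mono_set (Set.prod_mono (Set.subset_univ _) le_rfl)).trans
      (setLIntegral_snd_mul_compKer_le hn hτ B V)
  refine (add_le_add h2 h3).trans (le_of_eq ?_)
  ring

/-- For points at distance at least `δ`, the triangle inequality gives `1 + ‖y‖ ≤ 1 + ‖x‖ + ‖x - y‖
≤ Θ * ‖x - y‖`. The exponent of `Θ` is made uniform by `s * p ≤ P`. -/
lemma Admissible.inv_dist_rpow_le (h : Admissible s p K Λ τ P) {x y : Rn n} {δ Θ : ℝ}
    (hδ : 0 < δ) (hd : δ ≤ ‖x - y‖) (hΘ : 1 + ‖x‖ ≤ (Θ - 1) * δ) (hΘ1 : 1 ≤ Θ) :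
    1 / ‖x - y‖ ^ ((n : ℝ) + s x y * p x y) ≤
      Θ ^ ((n : ℝ) + P) * (1 / (1 + ‖y‖) ^ ((n : ℝ) + s x y * p x y)) := by
  have hd0 : 0 < ‖x - y‖ := hδ.trans_le hd
  have hs := h.τ_le x y
  have hs' := h.τ_le' x y
  have hτ := h.τ_pos
  have hp := h.one_lt_p x y
  have hp' := h.p_le x y
  have hsp : s x y * p x y ≤ P := by nlinarith
  have hsp0 : 0 ≤ s x y * p x y := mul_nonneg (by linarith) (by linarith)
  have h1 : 1 + ‖y‖ ≤ Θ * ‖x - y‖ := by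
    have h2 : ‖y‖ ≤ ‖x‖ + ‖x - y‖ := by
      have := norm_sub_le x (x - y)
      rwa [sub_sub_cancel] at this
    have h3 : (Θ - 1) * δ ≤ (Θ - 1) * ‖x - y‖ := mul_le_mul_of_nonneg_left hd (by linarith)
    linarith
  have h4 : (1 + ‖y‖) ^ ((n : ℝ) + s x y * p x y) ≤
      Θ ^ ((n : ℝ) + P) * ‖x - y‖ ^ ((n : ℝ) + s x y * p x y) := by
    refine (Real.rpow_le_rpow (by positivity) h1 (by positivity)).trans ?_
    rw [Real.mul_rpow (by linarith) hd0.le]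
    gcongr
  rw [mul_one_div, div_le_div_iff₀ (by positivity) (by positivity), one_mul]
  exact h4

/-- Pairs in this error are at distance at least `r - b`, so the kernel is comparable with the tail
kernel. The integral in `y` is then at most `T` for a.e. `x`, leaving a multiple of `(u - k)₊`,
which the weight dominates because `Q ≥ 1`. -/
lemma Admissible.lintegral_farError_le (h : Admissible s p K Λ τ P) {Ω : Set (Rn n)} {T : ℝ≥0∞}
    (hT : ∀ᵐ x ∂volume.restrict Ω, ∫⁻ y : Rn n, ENNReal.ofReal (|u y| ^ (p x y - 1) /
      (1 + ‖y‖) ^ ((n : ℝ) + s x y * p x y)) ≤ T) (hTtop : T ≠ ∞) (hQ : 1 ≤ Q)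
    (hbr : b < r) (hball : Metric.ball x₀ r ⊆ Ω) {Θ : ℝ}
    (hΘ : 1 + ‖x₀‖ + b ≤ (Θ - 1) * (r - b)) (hΘ1 : 1 ≤ Θ) :
    ∫⁻ z, ENNReal.ofReal (farError s p u k x₀ b r z) ≤
      ENNReal.ofReal (Θ ^ ((n : ℝ) + P)) * T *
        ∫⁻ x in Metric.ball x₀ r, ENNReal.ofReal (levelWeight u Q k x) := by
  have hsub : Metric.ball x₀ b ⊆ Metric.ball x₀ r := Metric.ball_subset_ball hbr.le
  have hpt : ∀ z, ENNReal.ofReal (farError s p u k x₀ b r z) ≤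
      (Metric.ball x₀ b ×ˢ (Set.univ : Set (Rn n))).indicator (fun z =>
        ENNReal.ofReal (Θ ^ ((n : ℝ) + P)) * ENNReal.ofReal (levelWeight u Q k z.1) *
          ENNReal.ofReal (|u z.2| ^ (p z.1 z.2 - 1) /
      (1 + ‖z.2‖) ^ ((n : ℝ) + s z.1 z.2 * p z.1 z.2))) z := by
    intro z
    by_cases hz : z ∈ Metric.ball x₀ b ×ˢ (Metric.ball x₀ r)ᶜ
    · have hz' : z ∈ Metric.ball x₀ b ×ˢ (Set.univ : Set (Rn n)) := ⟨hz.1, trivial⟩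
      rw [farError, Set.indicator_of_mem hz, Set.indicator_of_mem hz',
        ← ENNReal.ofReal_mul (by positivity),
        ← ENNReal.ofReal_mul (mul_nonneg (by positivity) (levelWeight_nonneg _))]
      apply ENNReal.ofReal_le_ofReal
      have hx : ‖z.1 - x₀‖ < b := by
        have := hz.1
        rwa [Metric.mem_ball, dist_eq_norm] at this
      have hy : r ≤ ‖z.2 - x₀‖ := by
        have := hz.2
        rwa [Set.mem_compl_iff, Metric.mem_ball, dist_eq_norm, not_lt] at this
      have hd : r - b ≤ ‖z.1 - z.2‖ := by
        have := norm_sub_norm_le (z.2 - x₀) (z.1 - x₀)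
        rw [sub_sub_sub_cancel_right, norm_sub_rev z.2 z.1] at this
        linarith
      have hx' : ‖z.1‖ ≤ ‖x₀‖ + b := by
        have := norm_add_le x₀ (z.1 - x₀)
        rw [add_sub_cancel] at this
        linarith
      have h1 := h.inv_dist_rpow_le (by linarith) hd (by linarith : 1 + ‖z.1‖ ≤ _) hΘ1
      have h2 := le_levelWeight (u := u) (k := k) hQ z.1
      calc max (u z.1 - k) 0 * (|u z.2| ^ (p z.1 z.2 - 1) /
            ‖z.1 - z.2‖ ^ ((n : ℝ) + s z.1 z.2 * p z.1 z.2))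
          = max (u z.1 - k) 0 * (|u z.2| ^ (p z.1 z.2 - 1) *
            (1 / ‖z.1 - z.2‖ ^ ((n : ℝ) + s z.1 z.2 * p z.1 z.2))) := by ring
        _ ≤ levelWeight u Q k z.1 * (|u z.2| ^ (p z.1 z.2 - 1) * (Θ ^ ((n : ℝ) + P) *
            (1 / (1 + ‖z.2‖) ^ ((n : ℝ) + s z.1 z.2 * p z.1 z.2)))) := by
            have := levelWeight_nonneg (u := u) (Q := Q) (k := k) z.1
            gcongr
        _ = _ := by ring
    · rw [farError, Set.indicator_of_notMem hz, ENNReal.ofReal_zero]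
      exact zero_le
  calc ∫⁻ z, ENNReal.ofReal (farError s p u k x₀ b r z) ≤ _ := lintegral_mono hpt
    _ = ∫⁻ z in Metric.ball x₀ b ×ˢ (Set.univ : Set (Rn n)),
        ENNReal.ofReal (Θ ^ ((n : ℝ) + P)) * ENNReal.ofReal (levelWeight u Q k z.1) *
          ENNReal.ofReal (|u z.2| ^ (p z.1 z.2 - 1) /
      (1 + ‖z.2‖) ^ ((n : ℝ) + s z.1 z.2 * p z.1 z.2)) :=
        lintegral_indicator (Metric.isOpen_ball.measurableSet.prod MeasurableSet.univ) _
    _ ≤ ∫⁻ x in Metric.ball x₀ b, ∫⁻ y, ENNReal.ofReal (Θ ^ ((n : ℝ) + P)) *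
          ENNReal.ofReal (levelWeight u Q k x) * ENNReal.ofReal (|u y| ^ (p x y - 1) /
      (1 + ‖y‖) ^ ((n : ℝ) + s x y * p x y)) := by
        rw [Measure.volume_eq_prod, ← Measure.prod_restrict, Measure.restrict_univ]
        exact lintegral_prod_le _
    _ ≤ ∫⁻ x in Metric.ball x₀ b, ENNReal.ofReal (Θ ^ ((n : ℝ) + P)) * T *
          ENNReal.ofReal (levelWeight u Q k x) := by
        apply lintegral_mono_ae
        filter_upwards [ae_restrict_of_ae_restrict_of_subset (hsub.trans hball) hT] with x hx
        rw [lintegral_const_mul' _ _ (ENNReal.mul_ne_top ENNReal.ofReal_ne_top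
          ENNReal.ofReal_ne_top), mul_assoc, mul_assoc, mul_comm T]
        gcongr
    _ = ENNReal.ofReal (Θ ^ ((n : ℝ) + P)) * T *
          ∫⁻ x in Metric.ball x₀ b, ENNReal.ofReal (levelWeight u Q k x) :=
        lintegral_const_mul' _ _ (ENNReal.mul_ne_top ENNReal.ofReal_ne_top hTtop)
    _ ≤ _ := by gcongr

/-- Lower bound for the weak integrand away from the support of the test function. -/
lemma Admissible.neg_farError_le_weakIntegrand (h : Admissible s p K Λ τ P) (hk : 0 ≤ k)
    {ψ : Rn n → ℝ} (hψ0 : ∀ x, 0 ≤ ψ x) (hψ : ∀ x, ψ x ≤ max (u x - k) 0)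
    (hψb : ∀ x, x ∉ Metric.ball x₀ b → ψ x = 0) (hbr : b ≤ r) :
    ∀ᵐ z : Rn n × Rn n, z ∉ Metric.ball x₀ r ×ˢ Metric.ball x₀ r →
      -(Λ * (farError s p u k x₀ b r z + farError s p u k x₀ b r z.swap)) ≤
        weakIntegrand p K u ψ z := by
  filter_upwards [h.bounds] with z hz hzr
  have hΛ := h.one_lt_Λ
  have hsub : Metric.ball x₀ b ⊆ Metric.ball x₀ r := Metric.ball_subset_ball hbr
  have hK0 : 0 ≤ K z.1 z.2 := le_trans (by positivity) hz.1
  have hf1 := farError_nonneg (s := s) (p := p) (u := u) (k := k) (x₀ := x₀) (b := b) (r := r) z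
  have hf2 := farError_nonneg (s := s) (p := p) (u := u) (k := k) (x₀ := x₀) (b := b) (r := r)
    z.swap
  by_cases h1 : z.1 ∈ Metric.ball x₀ b
  · have h2 : z.2 ∉ Metric.ball x₀ r := fun h2 => hzr ⟨hsub h1, h2⟩
    have hF : farError s p u k x₀ b r z = max (u z.1 - k) 0 * (|u z.2| ^ (p z.1 z.2 - 1) /
        ‖z.1 - z.2‖ ^ ((n : ℝ) + s z.1 z.2 * p z.1 z.2)) := by
      have hm : z ∈ Metric.ball x₀ b ×ˢ (Metric.ball x₀ r)ᶜ := ⟨h1, h2⟩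
      exact Set.indicator_of_mem hm _
    have h3 := neg_le_nonlinearity_mul (V := u z.2) (h.one_lt_p z.1 z.2) hk (hψ0 z.1) (hψ z.1)
    have h4 := mul_le_mul_of_nonneg_right h3 hK0
    have hw : 0 ≤ max (u z.1 - k) 0 := le_max_right _ _
    have h5 : |u z.2| ^ (p z.1 z.2 - 1) * max (u z.1 - k) 0 * K z.1 z.2 ≤
        Λ * farError s p u k x₀ b r z := by
      rw [hF]
      refine (mul_le_mul_of_nonneg_left hz.2 (by positivity)).trans (le_of_eq ?_)
      ring
    rw [weakIntegrand, hψb z.2 fun h' => h2 (hsub h'), sub_zero]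
    have h6 : 0 ≤ Λ * farError s p u k x₀ b r z.swap := by positivity
    linarith
  · by_cases h2 : z.2 ∈ Metric.ball x₀ b
    · have h1' : z.1 ∉ Metric.ball x₀ r := fun h1 => hzr ⟨h1, hsub h2⟩
      have hF : farError s p u k x₀ b r z.swap = max (u z.2 - k) 0 * (|u z.1| ^ (p z.2 z.1 - 1) /
          ‖z.2 - z.1‖ ^ ((n : ℝ) + s z.2 z.1 * p z.2 z.1)) := by
        have hm : z.swap ∈ Metric.ball x₀ b ×ˢ (Metric.ball x₀ r)ᶜ := ⟨h2, h1'⟩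
        exact Set.indicator_of_mem hm _
      -- Symmetry of `s` and `p` transfers the estimate to pairs whose second point lies in the
      -- support.
      rw [norm_sub_rev, h.p_symm z.2 z.1, h.s_symm z.2 z.1] at hF
      have h3 := neg_le_nonlinearity_mul (V := u z.1) (h.one_lt_p z.1 z.2) hk (hψ0 z.2) (hψ z.2)
      have h4 := mul_le_mul_of_nonneg_right h3 hK0
      have hw : 0 ≤ max (u z.2 - k) 0 := le_max_right _ _
      have h5 : |u z.1| ^ (p z.1 z.2 - 1) * max (u z.2 - k) 0 * K z.1 z.2 ≤
          Λ * farError s p u k x₀ b r z.swap := by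
        rw [hF]
        refine (mul_le_mul_of_nonneg_left hz.2 (by positivity)).trans (le_of_eq ?_)
        ring
      rw [weakIntegrand, hψb z.1 h1, zero_sub, abs_sub_comm]
      have h6 : 0 ≤ Λ * farError s p u k x₀ b r z := by positivity
      have h7 : |u z.2 - u z.1| ^ (p z.1 z.2 - 2) * (u z.1 - u z.2) * -ψ z.2 * K z.1 z.2
          = |u z.2 - u z.1| ^ (p z.1 z.2 - 2) * (u z.2 - u z.1) * ψ z.2 * K z.1 z.2 := by ring
      rw [h7]
      linarith
    · rw [weakIntegrand, hψb z.1 h1, hψb z.2 h2, sub_zero, mul_zero, zero_mul]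
      have : 0 ≤ Λ * (farError s p u k x₀ b r z + farError s p u k x₀ b r z.swap) := by positivity
      linarith

end

/-! ### Near-diagonal bounds and removal of the truncation -/

section

variable {n : ℕ} {s p K : Rn n → Rn n → ℝ} {Λ τ P Q : ℝ} {u : Rn n → ℝ} {k : ℝ}
  {x₀ : Rn n} {a b r M : ℝ} {m : ℕ}

/-- Uniform lower bound for the weak integrand with truncated test functions, near the diagonal. -/
lemma Admissible.neg_le_weakIntegrand_testFn (h : Admissible s p K Λ τ P)
    (hpQ : ∀ x ∈ Metric.ball x₀ r, ∀ y ∈ Metric.ball x₀ r, p x y ≤ Q)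
    (hM : 0 ≤ M) (hab : a < b) (hba : b - a ≤ 1) (hm : 1 ≤ m) :
    ∀ᵐ z : Rn n × Rn n, z ∈ Metric.ball x₀ r ×ˢ Metric.ball x₀ r →
      -(3 * Λ * energyDensity s p u z
        + Λ * (2 * (m * (m / (b - a)))) ^ P * nearError τ u Q k x₀ r z) ≤
        weakIntegrand p K u (testFn u k x₀ a b m M) z := by
  filter_upwards [h.abs_weakIntegrand_le u (testFn u k x₀ a b m M)] with z hz hzr
  have hΛ := h.one_lt_Λ
  have hp1 := h.one_lt_p z.1 z.2
  have hpP := h.p_le z.1 z.2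
  have hba0 : 0 < b - a := by linarith
  have hm' : (1 : ℝ) ≤ m := by exact_mod_cast hm
  set L : ℝ := m * (m / (b - a)) with hL
  have hL1 : 1 ≤ L := by
    have : 1 ≤ m / (b - a) := by rw [le_div_iff₀ hba0]; linarith
    rw [hL]; nlinarith
  refine neg_le.1 ((neg_le_abs _).trans (hz.trans ?_))
  set D := ‖z.1 - z.2‖ ^ ((n : ℝ) + s z.1 z.2 * p z.1 z.2) with hD
  have hD0 : 0 ≤ D := by positivity
  set A := |u z.1 - u z.2| with hA
  set w := max (u z.2 - k) 0 with hw
  have hw0 : 0 ≤ w := le_max_right _ _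
  set μ := min ‖z.1 - z.2‖ 1 with hμ
  have hμ0 : 0 ≤ μ := le_min (norm_nonneg _) zero_le_one
  have hA0 : 0 ≤ A := abs_nonneg _
  -- Dropping `min _ M` here makes the bound uniform in `M`. The price is the energy of `u` itself,
  -- which is harmless because the bound only has to be integrable.
  have h1 : |testFn u k x₀ a b m M z.1 - testFn u k x₀ a b m M z.2| ≤ A + w * (L * μ) := by
    refine (abs_testFn_sub_le hM hab hba hm).trans ?_
    gcongr
    exact min_le_left _ _
  have h2 : A ^ (p z.1 z.2 - 1) * |testFn u k x₀ a b m M z.1 - testFn u k x₀ a b m M z.2| ≤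
      3 * A ^ p z.1 z.2 + (2 * L) ^ P * (levelWeight u Q k z.2 * μ ^ p z.1 z.2) := by
    refine (mul_le_mul_of_nonneg_left h1 (by positivity)).trans ?_
    rw [mul_add]
    -- The first product costs `2 * A ^ p`, the second one more `A ^ p`; hence the factor `3`.
    have h3 := rpow_sub_one_mul_le hA0 hA0 hp1
    have h4 := rpow_sub_one_mul_le hA0 (by positivity : 0 ≤ w * (L * μ)) hp1
    have h5 : (w * (L * μ)) ^ p z.1 z.2 ≤
        (2 * L) ^ P * (levelWeight u Q k z.2 * μ ^ p z.1 z.2) := by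
      rw [Real.mul_rpow hw0 (by positivity), Real.mul_rpow (by positivity) hμ0]
      have h6 : w ^ p z.1 z.2 ≤ levelWeight u Q k z.2 :=
        rpow_le_levelWeight (by linarith) (hpQ _ hzr.1 _ hzr.2) z.2
      have h7 : L ^ p z.1 z.2 ≤ (2 * L) ^ P :=
        (Real.rpow_le_rpow (by linarith) (by linarith) (by linarith)).trans
          (Real.rpow_le_rpow_of_exponent_le (by linarith) hpP)
      calc _ ≤ levelWeight u Q k z.2 * ((2 * L) ^ P * μ ^ p z.1 z.2) := by
            have := levelWeight_nonneg (u := u) (Q := Q) (k := k) z.2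
            gcongr
        _ = _ := by ring
    linarith
  have hnear : nearError τ u Q k x₀ r z =
      (levelWeight u Q k z.1 + levelWeight u Q k z.2) * compKer n τ z :=
    Set.indicator_of_mem hzr _
  have hker : μ ^ p z.1 z.2 / D ≤ compKer n τ z := h.min_rpow_div_le z
  have hV1 := levelWeight_nonneg (u := u) (Q := Q) (k := k) z.1
  have hV2 := levelWeight_nonneg (u := u) (Q := Q) (k := k) z.2
  have hc := compKer_nonneg (τ := τ) z
  calc Λ * (A ^ (p z.1 z.2 - 1) *
        |testFn u k x₀ a b m M z.1 - testFn u k x₀ a b m M z.2| / D)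
      ≤ Λ * ((3 * A ^ p z.1 z.2 + (2 * L) ^ P * (levelWeight u Q k z.2 * μ ^ p z.1 z.2)) / D) := by
        gcongr
    _ = 3 * Λ * (A ^ p z.1 z.2 / D)
        + Λ * (2 * L) ^ P * (levelWeight u Q k z.2 * (μ ^ p z.1 z.2 / D)) := by ring
    _ ≤ 3 * Λ * (A ^ p z.1 z.2 / D)
        + Λ * (2 * L) ^ P * (levelWeight u Q k z.2 * compKer n τ z) := by gcongr
    _ ≤ 3 * Λ * (A ^ p z.1 z.2 / D)
        + Λ * (2 * L) ^ P * nearError τ u Q k x₀ r z := by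
        rw [hnear]
        gcongr
        linarith

/-- Coercivity of the weak integrand near the diagonal. -/
lemma Admissible.le_weakIntegrand_cutoff (h : Admissible s p K Λ τ P)
    (hpQ : ∀ x ∈ Metric.ball x₀ r, ∀ y ∈ Metric.ball x₀ r, p x y ≤ Q)
    (hab : a < b) (hba : b - a ≤ 1) (hm : P ≤ m) :
    ∀ᵐ z : Rn n × Rn n, z ∈ Metric.ball x₀ r ×ˢ Metric.ball x₀ r →
      (Metric.ball x₀ a ×ˢ Metric.ball x₀ a).indicator (fun z => 1 / 2 * Λ⁻¹ *
          energyDensity s p (fun x => max (u x - k) 0) z) z ≤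
        weakIntegrand p K u (fun x => max (u x - k) 0 * cutoff x₀ a b x ^ m) z
        + Λ * (2 * (m * (m / (b - a)))) ^ P * nearError τ u Q k x₀ r z := by
  filter_upwards [h.bounds] with z hz hzr
  have hΛ := h.one_lt_Λ
  have hp1 := h.one_lt_p z.1 z.2
  have hpP := h.p_le z.1 z.2
  have hba0 : 0 < b - a := by linarith
  have hm' : (1 : ℝ) ≤ m := h.one_lt_P.le.trans hm
  have hm1 : 1 ≤ m := by exact_mod_cast hm'
  have hK0 : 0 ≤ K z.1 z.2 := le_trans (by positivity) hz.1
  set w : Rn n → ℝ := fun x => max (u x - k) 0 with hw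
  set e := cutoff x₀ a b z.1 with he
  set f := cutoff x₀ a b z.2 with hf
  set D := ‖z.1 - z.2‖ ^ ((n : ℝ) + s z.1 z.2 * p z.1 z.2) with hD
  have hD0 : 0 ≤ D := by positivity
  set L : ℝ := m / (b - a) with hL
  have hL1 : 1 ≤ L := by rw [hL, le_div_iff₀ hba0]; linarith
  have hw1 : 0 ≤ w z.1 := le_max_right _ _
  have hw2 : 0 ≤ w z.2 := le_max_right _ _
  have hV1 := levelWeight_nonneg (u := u) (Q := Q) (k := k) z.1
  have hV2 := levelWeight_nonneg (u := u) (Q := Q) (k := k) z.2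
  have hmain := caccioppoli_pointwise (U := u z.1) (V := u z.2) (k := k) hp1 (hpP.trans hm)
    (cutoff_nonneg : 0 ≤ e) cutoff_le_one (cutoff_nonneg : 0 ≤ f) cutoff_le_one
  have hmainK := mul_le_mul_of_nonneg_right hmain hK0
  rw [sub_mul] at hmainK
  have hgood : (Metric.ball x₀ a ×ˢ Metric.ball x₀ a).indicator (fun z => 1 / 2 * Λ⁻¹ *
          energyDensity s p w z) z ≤
      1 / 2 * |w z.1 - w z.2| ^ p z.1 z.2 * min e f ^ m * K z.1 z.2 := by
    by_cases hza : z ∈ Metric.ball x₀ a ×ˢ Metric.ball x₀ a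
    · have he1 : e = 1 := cutoff_eq_one hab hza.1
      have hf1 : f = 1 := cutoff_eq_one hab hza.2
      rw [Set.indicator_of_mem hza, he1, hf1, min_self, one_pow, mul_one]
      refine le_trans (le_of_eq ?_) (mul_le_mul_of_nonneg_left hz.1 (by positivity))
      simp only [energyDensity]
      ring
    · rw [Set.indicator_of_notMem hza]
      have : 0 ≤ min e f := le_min cutoff_nonneg cutoff_nonneg
      positivity
  have hbad : (2 * m : ℝ) ^ p z.1 z.2 * max (w z.1) (w z.2) ^ p z.1 z.2 * |e - f| ^ p z.1 z.2
      * K z.1 z.2 ≤ Λ * (2 * (m * L)) ^ P * nearError τ u Q k x₀ r z := by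
    set μ := min ‖z.1 - z.2‖ 1 with hμ
    have hμ0 : 0 ≤ μ := le_min (norm_nonneg _) zero_le_one
    have hnear : nearError τ u Q k x₀ r z =
        (levelWeight u Q k z.1 + levelWeight u Q k z.2) * compKer n τ z :=
      Set.indicator_of_mem hzr _
    have hker : μ ^ p z.1 z.2 / D ≤ compKer n τ z := h.min_rpow_div_le z
    have h1 : max (w z.1) (w z.2) ^ p z.1 z.2 ≤ levelWeight u Q k z.1 + levelWeight u Q k z.2 := by
      have h2 := rpow_le_levelWeight (u := u) (k := k) (by linarith : 0 < p z.1 z.2)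
        (hpQ _ hzr.1 _ hzr.2) z.1
      have h3 := rpow_le_levelWeight (u := u) (k := k) (by linarith : 0 < p z.1 z.2)
        (hpQ _ hzr.1 _ hzr.2) z.2
      rcases max_choice (w z.1) (w z.2) with h4 | h4 <;> rw [h4] <;> simp only [hw] <;> linarith
    have h2 : |e - f| ^ p z.1 z.2 ≤ L ^ p z.1 z.2 * μ ^ p z.1 z.2 := by
      rw [← Real.mul_rpow (by linarith) hμ0]
      exact Real.rpow_le_rpow (abs_nonneg _) (abs_cutoff_sub_le_min hab hba hm1) (by linarith)
    have h3 : (2 * m : ℝ) ^ p z.1 z.2 * L ^ p z.1 z.2 ≤ (2 * (m * L)) ^ P := by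
      rw [← Real.mul_rpow (by positivity) (by linarith), mul_assoc]
      apply Real.rpow_le_rpow_of_exponent_le _ hpP
      nlinarith
    have hc := compKer_nonneg (τ := τ) z
    calc (2 * m : ℝ) ^ p z.1 z.2 * max (w z.1) (w z.2) ^ p z.1 z.2 * |e - f| ^ p z.1 z.2 * K z.1 z.2
        ≤ (2 * m : ℝ) ^ p z.1 z.2 * (levelWeight u Q k z.1 + levelWeight u Q k z.2)
          * (L ^ p z.1 z.2 * μ ^ p z.1 z.2) * (Λ / D) := by
          gcongr
          exact hz.2
      _ = Λ * ((2 * m : ℝ) ^ p z.1 z.2 * L ^ p z.1 z.2) *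
          ((levelWeight u Q k z.1 + levelWeight u Q k z.2) * (μ ^ p z.1 z.2 / D)) := by ring
      _ ≤ Λ * (2 * (m * L)) ^ P *
          ((levelWeight u Q k z.1 + levelWeight u Q k z.2) * compKer n τ z) := by gcongr
      _ = _ := by rw [hnear]
  have hJ : weakIntegrand p K u (fun x => max (u x - k) 0 * cutoff x₀ a b x ^ m) z
      = |u z.1 - u z.2| ^ (p z.1 z.2 - 2) * (u z.1 - u z.2) *
        (max (u z.1 - k) 0 * e ^ m - max (u z.2 - k) 0 * f ^ m) * K z.1 z.2 := rfl
  rw [hJ]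
  simp only [hw] at hgood hbad ⊢
  linarith

/-- The Caccioppoli estimate with its error terms. -/
lemma Admissible.caccioppoli_error (h : Admissible s p K Λ τ P) (hn : 1 ≤ n) {Ω : Set (Rn n)}
    (hΩ : IsOpen Ω) (hΩb : Bornology.IsBounded Ω) (hu : IsWeakSolution s p K Ω u)
    (hpQ : ∀ x ∈ Metric.ball x₀ r, ∀ y ∈ Metric.ball x₀ r, p x y ≤ Q)
    (hk : 0 ≤ k) (hab : a < b) (hba : b - a ≤ 1) (hbr : b ≤ r) (hball : Metric.ball x₀ r ⊆ Ω)
    (hm : P ≤ m) (hnear : ∫⁻ z, ENNReal.ofReal (nearError τ u Q k x₀ r z) ≠ ∞)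
    (hfar : ∫⁻ z, ENNReal.ofReal (farError s p u k x₀ b r z) ≠ ∞) :
    ∫⁻ z in Metric.ball x₀ a ×ˢ Metric.ball x₀ a, ENNReal.ofReal (energyDensity s p
      (fun x => max (u x - k) 0) z) ≤ ENNReal.ofReal (2 * Λ) *
        (ENNReal.ofReal (Λ * (2 * (m * (m / (b - a)))) ^ P) *
            (∫⁻ z, ENNReal.ofReal (nearError τ u Q k x₀ r z))
          + ENNReal.ofReal (2 * Λ) * ∫⁻ z, ENNReal.ofReal (farError s p u k x₀ b r z)) := by
  have hΛ := h.one_lt_Λ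
  have hm' : (1 : ℝ) ≤ m := h.one_lt_P.le.trans hm
  have hm1 : 1 ≤ m := by exact_mod_cast hm'
  have hba0 : 0 < b - a := by linarith
  have hum := hu.memW.aemeasurable
  set A : ℝ := Λ * (2 * (m * (m / (b - a)))) ^ P with hA
  have hA0 : 0 ≤ A := by positivity
  set G := nearError τ u Q k x₀ r with hG
  set F := farError s p u k x₀ b r with hF
  have hG0 : ∀ z, 0 ≤ G z := nearError_nonneg
  have hF0 : ∀ z, 0 ≤ F z := farError_nonneg
  have hGi : Integrable G volume := by
    refine ⟨(aemeasurable_nearError hum).aestronglyMeasurable, ?_⟩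
    rw [hasFiniteIntegral_iff_ofReal (Eventually.of_forall hG0)]
    exact lt_top_iff_ne_top.2 hnear
  have hFi : Integrable F volume := by
    refine ⟨(h.aemeasurable_farError hum).aestronglyMeasurable, ?_⟩
    rw [hasFiniteIntegral_iff_ofReal (Eventually.of_forall hF0)]
    exact lt_top_iff_ne_top.2 hfar
  have hFs : Integrable (fun z : Rn n × Rn n => F z.swap) volume := hFi.swap
  set E : Rn n × Rn n → ℝ := fun z => A * G z + Λ * (F z + F z.swap) with hE
  have hE0 : ∀ z, 0 ≤ E z := fun z => by
    have := hG0 z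
    have := hF0 z
    have := hF0 z.swap
    simp only [hE]
    positivity
  have hEi : Integrable E volume := (hGi.const_mul A).add ((hFi.add hFs).const_mul Λ)
  set μ := volume.restrict (crossSet Ω) with hμ
  have hBa : MeasurableSet (Metric.ball x₀ a ×ˢ Metric.ball x₀ a) :=
    Metric.isOpen_ball.measurableSet.prod Metric.isOpen_ball.measurableSet
  set w : Rn n → ℝ := fun x => max (u x - k) 0 with hw
  have hBaΩ : Metric.ball x₀ a ×ˢ Metric.ball x₀ a ⊆ crossSet Ω := by
    intro z hz hz'
    exact hz'.1 (hball (Metric.ball_subset_ball (hab.le.trans hbr) hz.1))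
  have hnotnear : ∀ z : Rn n × Rn n, z ∉ Metric.ball x₀ r ×ˢ Metric.ball x₀ r →
      z ∉ Metric.ball x₀ a ×ˢ Metric.ball x₀ a := fun z hz hz' =>
    hz (Set.prod_mono (Metric.ball_subset_ball (hab.le.trans hbr))
      (Metric.ball_subset_ball (hab.le.trans hbr)) hz')
  have hmemW : ∀ M : ℕ, MemW s p Ω (testFn u k x₀ a b m M) := fun M =>
    h.memW_testFn hn hΩb hu.memW (by positivity) hab hba hm1
  -- `H` is the crude minorant used for Fatou and contains the energy of `u`; the estimate retains
  -- only `E`, the error in the coercive bound for the limiting integrand.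
  have key := lintegral_le_of_tendsto_of_integral_eq_zero (μ := μ)
    (J := fun M : ℕ => weakIntegrand p K u (testFn u k x₀ a b m M))
    (J' := weakIntegrand p K u (fun x => w x * cutoff x₀ a b x ^ m))
    (H := fun z => 3 * Λ * energyDensity s p u z + E z) (E := E)
    (P := (Metric.ball x₀ a ×ˢ Metric.ball x₀ a).indicator (fun z => 1 / 2 * Λ⁻¹ *
          energyDensity s p w z))
    (fun M => h.integrable_weakIntegrand hu.memW (hmemW M))
    (fun M => by
      refine hu.weak_form _ (hmemW M) ?_
      filter_upwards [ae_restrict_mem hΩ.measurableSet.compl] with x hx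
      refine testFn_eq_zero hab hm1 fun hx' => hx (hball (Metric.ball_subset_ball hbr hx')))
    (by
      refine Eventually.of_forall fun z => ?_
      -- For a fixed pair the truncation is inactive as soon as `M` exceeds both values.
      apply tendsto_const_nhds.congr'
      filter_upwards [eventually_ge_atTop ⌈max (w z.1) (w z.2)⌉₊] with M hM
      have hM' : max (w z.1) (w z.2) ≤ M := Nat.ceil_le.1 hM
      have h1 : testFn u k x₀ a b m M z.1 = w z.1 * cutoff x₀ a b z.1 ^ m := by
        rw [testFn, min_eq_left ((le_max_left _ _).trans hM')]
      have h2 : testFn u k x₀ a b m M z.2 = w z.2 * cutoff x₀ a b z.2 ^ m := by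
        rw [testFn, min_eq_left ((le_max_right _ _).trans hM')]
      simp only [weakIntegrand, h1, h2])
    (((h.integrable_energyDensity hu.memW).const_mul _).add hEi.restrict)
    (fun M => by
      apply ae_restrict_of_ae
      filter_upwards [h.neg_le_weakIntegrand_testFn (u := u) (k := k) (M := M) hpQ (by positivity)
        hab hba hm1, h.neg_farError_le_weakIntegrand (u := u) (k := k) (b := b) (r := r) hk
        (ψ := testFn u k x₀ a b m M) (x₀ := x₀)
        (fun x => testFn_nonneg (by positivity)) (fun x => testFn_le_left (by positivity))
        (fun x hx => testFn_eq_zero hab hm1 hx) hbr] with z h1 h2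
      have hg := mul_nonneg hA0 (hG0 z)
      have hf : 0 ≤ Λ * (F z + F z.swap) :=
        mul_nonneg (by linarith) (add_nonneg (hF0 z) (hF0 z.swap))
      have he : 0 ≤ 3 * Λ * energyDensity s p u z :=
        mul_nonneg (by linarith) (energyDensity_nonneg z)
      by_cases hz : z ∈ Metric.ball x₀ r ×ˢ Metric.ball x₀ r
      · have := h1 hz
        simp only [hE]
        linarith
      · have := h2 hz
        simp only [hE]
        linarith)
    hEi.restrict hE0
    (Eventually.of_forall fun z => Set.indicator_nonneg (fun z _ =>
      mul_nonneg (by positivity) (energyDensity_nonneg z)) z)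
    (by
      apply ae_restrict_of_ae
      filter_upwards [h.le_weakIntegrand_cutoff (u := u) (k := k) hpQ hab hba hm,
        h.neg_farError_le_weakIntegrand (u := u) (k := k) (b := b) (r := r) hk
        (ψ := fun x => w x * cutoff x₀ a b x ^ m) (x₀ := x₀)
        (fun x => mul_nonneg (le_max_right _ _) (pow_nonneg cutoff_nonneg _))
        (fun x => mul_le_of_le_one_right (le_max_right _ _)
          (pow_le_one₀ cutoff_nonneg cutoff_le_one))
        (fun x hx => by
          rw [cutoff_eq_zero hab hx, zero_pow (by omega), mul_zero]) hbr] with z h1 h2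
      have hg := mul_nonneg hA0 (hG0 z)
      have hf : 0 ≤ Λ * (F z + F z.swap) :=
        mul_nonneg (by linarith) (add_nonneg (hF0 z) (hF0 z.swap))
      by_cases hz : z ∈ Metric.ball x₀ r ×ˢ Metric.ball x₀ r
      · have := h1 hz
        simp only [hE]
        linarith
      · have := h2 hz
        rw [Set.indicator_of_notMem (hnotnear z hz)]
        simp only [hE]
        linarith)
  have hleft : ∫⁻ z, ENNReal.ofReal ((Metric.ball x₀ a ×ˢ Metric.ball x₀ a).indicator
      (fun z => 1 / 2 * Λ⁻¹ * energyDensity s p w z) z) ∂μ =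
      ENNReal.ofReal (1 / 2 * Λ⁻¹) * ∫⁻ z in Metric.ball x₀ a ×ˢ Metric.ball x₀ a,
        ENNReal.ofReal (energyDensity s p w z) := by
    have h1 : ∀ z, ENNReal.ofReal ((Metric.ball x₀ a ×ˢ Metric.ball x₀ a).indicator
        (fun z => 1 / 2 * Λ⁻¹ * energyDensity s p w z) z) =
        (Metric.ball x₀ a ×ˢ Metric.ball x₀ a).indicator
        (fun z => ENNReal.ofReal (1 / 2 * Λ⁻¹) * ENNReal.ofReal (energyDensity s p w z)) z := by
      intro z
      by_cases hz : z ∈ Metric.ball x₀ a ×ˢ Metric.ball x₀ a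
      · rw [Set.indicator_of_mem hz, Set.indicator_of_mem hz, ENNReal.ofReal_mul (by positivity)]
      · rw [Set.indicator_of_notMem hz, Set.indicator_of_notMem hz, ENNReal.ofReal_zero]
    rw [lintegral_congr h1, lintegral_indicator hBa, hμ, Measure.restrict_restrict hBa,
      Set.inter_eq_left.2 hBaΩ, lintegral_const_mul' _ _ ENNReal.ofReal_ne_top]
  have hright : ∫⁻ z, ENNReal.ofReal (E z) ∂μ ≤ ENNReal.ofReal A * (∫⁻ z, ENNReal.ofReal (G z))
      + ENNReal.ofReal (2 * Λ) * ∫⁻ z, ENNReal.ofReal (F z) := by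
    refine (setLIntegral_le_lintegral _ _).trans (le_of_eq ?_)
    have h1 : ∀ z, ENNReal.ofReal (E z) = ENNReal.ofReal A * ENNReal.ofReal (G z)
        + ENNReal.ofReal Λ * (ENNReal.ofReal (F z) + ENNReal.ofReal (F z.swap)) := by
      intro z
      simp only [hE]
      rw [ENNReal.ofReal_add (mul_nonneg hA0 (hG0 z))
        (mul_nonneg (by linarith) (add_nonneg (hF0 z) (hF0 z.swap))), ENNReal.ofReal_mul hA0,
        ENNReal.ofReal_mul (p := Λ) (q := F z + F z.swap) (by linarith),
        ENNReal.ofReal_add (hF0 z) (hF0 z.swap)]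
    have h2 : ∫⁻ z : Rn n × Rn n, ENNReal.ofReal (F z.swap) = ∫⁻ z, ENNReal.ofReal (F z) := by
      rw [Measure.volume_eq_prod]
      exact lintegral_prod_swap (fun z => ENNReal.ofReal (F z))
    rw [lintegral_congr h1, lintegral_add_left' (hGi.aemeasurable.ennreal_ofReal.const_mul _),
      lintegral_const_mul' _ _ ENNReal.ofReal_ne_top, lintegral_const_mul' _ _
      ENNReal.ofReal_ne_top, lintegral_add_left' hFi.aemeasurable.ennreal_ofReal, h2,
      ENNReal.ofReal_mul (p := 2) (q := Λ) (by norm_num), ENNReal.ofReal_ofNat]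
    ring
  rw [hleft] at key
  have hone : ENNReal.ofReal (2 * Λ) * ENNReal.ofReal (1 / 2 * Λ⁻¹) = 1 := by
    rw [← ENNReal.ofReal_mul (by linarith), ← ENNReal.ofReal_one]
    congr 1
    field_simp
  calc ∫⁻ z in Metric.ball x₀ a ×ˢ Metric.ball x₀ a, ENNReal.ofReal (energyDensity s p w z)
      = ENNReal.ofReal (2 * Λ) * (ENNReal.ofReal (1 / 2 * Λ⁻¹) *
        ∫⁻ z in Metric.ball x₀ a ×ˢ Metric.ball x₀ a, ENNReal.ofReal (energyDensity s p w z)) := by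
        rw [← mul_assoc, hone, one_mul]
    _ ≤ _ := by gcongr; exact key.trans hright

end

/-! ### The Caccioppoli estimate with explicit dependence on the radii -/

section

variable {n : ℕ} {s p K : Rn n → Rn n → ℝ} {Λ τ P Q q : ℝ} {u : Rn n → ℝ} {Ω : Set (Rn n)}
  {x₀ : Rn n} {R : ℝ}

lemma lintegral_levelWeight_ne_top (hQ : 0 ≤ Q) {k : ℝ} (hk : 0 ≤ k)
    (huQ : ∫⁻ x in Metric.ball x₀ R, ENNReal.ofReal (|u x| ^ Q) ≠ ∞) {r : ℝ} (hr : r ≤ R) :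
    ∫⁻ x in Metric.ball x₀ r, ENNReal.ofReal (levelWeight u Q k x) ≠ ∞ := by
  refine ((lintegral_mono_set (Metric.ball_subset_ball hr)).trans_lt ?_).ne
  calc ∫⁻ x in Metric.ball x₀ R, ENNReal.ofReal (levelWeight u Q k x)
      ≤ ∫⁻ x in Metric.ball x₀ R, (ENNReal.ofReal (|u x| ^ Q) + 1) := by
        apply lintegral_mono
        intro x
        change ENNReal.ofReal (levelWeight u Q k x) ≤ ENNReal.ofReal (|u x| ^ Q) + 1
        rw [← ENNReal.ofReal_one, ← ENNReal.ofReal_add (by positivity) zero_le_one]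
        exact ENNReal.ofReal_le_ofReal (levelWeight_le hQ hk x)
    _ = (∫⁻ x in Metric.ball x₀ R, ENNReal.ofReal (|u x| ^ Q)) + volume (Metric.ball x₀ R) := by
        rw [lintegral_add_right _ measurable_const, setLIntegral_one]
    _ < ∞ := ENNReal.add_lt_top.2 ⟨lt_top_iff_ne_top.2 huQ, measure_ball_lt_top⟩

/-- The Caccioppoli estimate on concentric balls. -/
lemma Admissible.exists_caccioppoli (h : Admissible s p K Λ τ P) (hn : 1 ≤ n)
    (hΩ : IsOpen Ω) (hΩb : Bornology.IsBounded Ω) (hu : IsWeakSolution s p K Ω u)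
    (hut : MemTail s p Ω u) (hR1 : R ≤ 1) (hball : Metric.ball x₀ R ⊆ Ω) (hQ : 1 ≤ Q)
    (hpQ : ∀ x ∈ Metric.ball x₀ R, ∀ y ∈ Metric.ball x₀ R, p x y ≤ Q)
    (huQ : ∫⁻ x in Metric.ball x₀ R, ENNReal.ofReal (|u x| ^ Q) ≠ ∞) :
    ∃ C : ℝ, 0 < C ∧ ∀ k ρ r : ℝ, 0 ≤ k → 0 < ρ → ρ < r → r ≤ R →
      ∫⁻ z in Metric.ball x₀ ρ ×ˢ Metric.ball x₀ ρ, ENNReal.ofReal (energyDensity s p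
        (fun x => max (u x - k) 0) z) ≤ ENNReal.ofReal (C * (r - ρ) ^ (-((n : ℝ) + P))) *
          ∫⁻ x in Metric.ball x₀ r, ENNReal.ofReal (levelWeight u Q k x) := by
  have hΛ := h.one_lt_Λ
  have hP := h.one_lt_P
  obtain ⟨m, hm⟩ := exists_nat_ge P
  have hm' : (1 : ℝ) ≤ m := hP.le.trans hm
  have hker := lintegral_kerProfile_lt_top hn h.τ_pos
  set κ : ℝ := (∫⁻ y : Rn n, ENNReal.ofReal (kerProfile n τ ‖y‖)).toReal with hκ
  have hκ0 : 0 ≤ κ := ENNReal.toReal_nonneg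
  have hκe : ∫⁻ y : Rn n, ENNReal.ofReal (kerProfile n τ ‖y‖) = ENNReal.ofReal κ :=
    (ENNReal.ofReal_toReal hker.ne).symm
  set T := essSup (fun x : Rn n => ∫⁻ y : Rn n,
    ENNReal.ofReal (|u y| ^ (p x y - 1) / (1 + ‖y‖) ^ ((n : ℝ) + s x y * p x y)))
      (volume.restrict Ω) with hT
  have hTtop : T ≠ ∞ := hut.essSup_lt_top.ne
  have hTae : ∀ᵐ x ∂volume.restrict Ω, ∫⁻ y : Rn n,
    ENNReal.ofReal (|u y| ^ (p x y - 1) / (1 + ‖y‖) ^ ((n : ℝ) + s x y * p x y)) ≤ T :=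
    ae_le_essSup
  have hTe : T = ENNReal.ofReal T.toReal := (ENNReal.ofReal_toReal hTtop).symm
  set t := T.toReal with ht
  have ht0 : 0 ≤ t := ENNReal.toReal_nonneg
  set N : ℝ := (n : ℝ) + P with hN
  have hN0 : 0 < N := by positivity
  set C₀ : ℝ := 2 * Λ * (Λ * (2 * (m * m)) ^ N * (2 * κ) + 2 * Λ * ((3 + ‖x₀‖) ^ N * t)) with hC₀
  have hC₀0 : 0 ≤ C₀ := by positivity
  -- `C₀` is only known to be nonnegative; the `+ 1` makes the constant positive.
  refine ⟨C₀ * 2 ^ N + 1, by positivity, ?_⟩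
  intro k ρ r hk hρ hρr hrR
  set δ := (r - ρ) / 2 with hδ
  have hδ0 : 0 < δ := by rw [hδ]; linarith
  have hδ1 : δ ≤ 1 := by rw [hδ]; linarith
  -- The cutoff drops to zero at the midpoint: one half of the gap bounds its slope, the other
  -- separates its support from the distant points.
  set b := (ρ + r) / 2 with hb
  have hbρ : b - ρ = δ := by rw [hb, hδ]; ring
  have hrb : r - b = δ := by rw [hb, hδ]; ring
  set Y := ∫⁻ x in Metric.ball x₀ r, ENNReal.ofReal (levelWeight u Q k x) with hY
  have hYtop : Y ≠ ∞ :=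
    lintegral_levelWeight_ne_top (by linarith) hk huQ hrR
  have hballr : Metric.ball x₀ r ⊆ Metric.ball x₀ R := Metric.ball_subset_ball hrR
  -- Then `(Θ - 1) * δ = 3 + ‖x₀‖ - δ`, which is at least `1 + ‖x₀‖ + b` because `b + δ = r ≤ 1`.
  set Θ : ℝ := (3 + ‖x₀‖) / δ with hΘ
  have hΘ1 : 1 ≤ Θ := by rw [hΘ, le_div_iff₀ hδ0]; linarith [norm_nonneg x₀]
  have hnear := lintegral_nearError_le (Q := Q) (k := k) (x₀ := x₀) (r := r) hn h.τ_pos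
    hu.memW.aemeasurable
  have hfar := h.lintegral_farError_le (k := k) (x₀ := x₀) (b := b) (r := r) (Q := Q) (Θ := Θ)
    hTae hTtop hQ (by linarith) (hballr.trans hball) (by
      rw [hrb, sub_mul, hΘ, div_mul_cancel₀ _ hδ0.ne']
      linarith) hΘ1
  have hmain := h.caccioppoli_error (k := k) (a := ρ) (b := b) (r := r) (x₀ := x₀) (Q := Q) hn hΩ
    hΩb hu (fun x hx y hy => hpQ x (hballr hx) y (hballr hy)) hk (by linarith) (by linarith)
    (by linarith) (hballr.trans hball) hm
    (ne_top_of_le_ne_top (ENNReal.mul_ne_top (ENNReal.mul_ne_top (by norm_num) hker.ne) hYtop)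
      hnear)
    (ne_top_of_le_ne_top (ENNReal.mul_ne_top (ENNReal.mul_ne_top ENNReal.ofReal_ne_top hTtop)
      hYtop) hfar)
  refine hmain.trans ?_
  rw [hκe] at hnear
  rw [hTe] at hfar
  rw [hbρ]
  calc ENNReal.ofReal (2 * Λ) * (ENNReal.ofReal (Λ * (2 * (m * (m / δ))) ^ P) *
            (∫⁻ z, ENNReal.ofReal (nearError τ u Q k x₀ r z))
          + ENNReal.ofReal (2 * Λ) * ∫⁻ z, ENNReal.ofReal (farError s p u k x₀ b r z))
      ≤ ENNReal.ofReal (2 * Λ) * (ENNReal.ofReal (Λ * (2 * (m * (m / δ))) ^ P) *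
            (2 * ENNReal.ofReal κ * Y)
          + ENNReal.ofReal (2 * Λ) * (ENNReal.ofReal (Θ ^ N) * ENNReal.ofReal t * Y)) := by
        gcongr
    _ = ENNReal.ofReal (2 * Λ * (Λ * (2 * (m * (m / δ))) ^ P * (2 * κ)
          + 2 * Λ * (Θ ^ N * t))) * Y := by
        have hΘ0 : 0 ≤ Θ := by linarith
        rw [ENNReal.ofReal_mul (p := 2 * Λ) (by positivity), ENNReal.ofReal_add (by positivity)
          (by positivity), ENNReal.ofReal_mul (p := Λ * (2 * (m * (m / δ))) ^ P) (by positivity),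
          ENNReal.ofReal_mul (p := 2 * Λ) (q := Θ ^ N * t) (by positivity),
          ENNReal.ofReal_mul (p := Θ ^ N) (by positivity),
          ENNReal.ofReal_mul (p := 2) (q := κ) (by norm_num), ENNReal.ofReal_ofNat]
        ring
    _ ≤ _ := by
        refine mul_le_mul' (ENNReal.ofReal_le_ofReal ?_) le_rfl
        have h1 : (2 * (m * (m / δ))) ^ P ≤ (2 * (m * m)) ^ N * δ ^ (-N) := by
          have h2 : (2 * (m * m)) ^ N * δ ^ (-N) = (2 * (m * (m / δ))) ^ N := by
            rw [Real.rpow_neg hδ0.le, ← div_eq_mul_inv, ← Real.div_rpow (by positivity) hδ0.le]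
            congr 1
            ring
          rw [h2]
          apply Real.rpow_le_rpow_of_exponent_le _ (by rw [hN]; linarith)
          have h3 : 1 ≤ m / δ := by rw [le_div_iff₀ hδ0]; linarith
          nlinarith
        have h2 : Θ ^ N = (3 + ‖x₀‖) ^ N * δ ^ (-N) := by
          rw [hΘ, Real.div_rpow (by positivity) hδ0.le, Real.rpow_neg hδ0.le, div_eq_mul_inv]
        have h3 : δ ^ (-N) = 2 ^ N * (r - ρ) ^ (-N) := by
          rw [hδ, Real.div_rpow (by linarith) (by norm_num), Real.rpow_neg (x := 2) (by norm_num),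
            div_inv_eq_mul, mul_comm]
        have hpos : 0 ≤ (r - ρ) ^ (-N) := Real.rpow_nonneg (by linarith) _
        calc 2 * Λ * (Λ * (2 * (m * (m / δ))) ^ P * (2 * κ) + 2 * Λ * (Θ ^ N * t))
            ≤ 2 * Λ * (Λ * ((2 * (m * m)) ^ N * δ ^ (-N)) * (2 * κ)
              + 2 * Λ * ((3 + ‖x₀‖) ^ N * δ ^ (-N) * t)) := by
              rw [h2]; gcongr
          _ = C₀ * δ ^ (-N) := by rw [hC₀]; ring
          _ = C₀ * 2 ^ N * (r - ρ) ^ (-N) := by rw [h3]; ring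
          _ ≤ _ := by rw [add_mul]; linarith

/-! ### The De Giorgi iteration -/

/-- Chebyshev's argument: where `u > l`, the quotient `(u - k)₊ / (l - k)` is at least `1`, so its
exponent may be raised to `t`. Both summands of the weight are bounded by that power, the first
because `l - k ≤ 1`. In the iteration `t = q * κ`, which is where `Q ≤ q * κ` enters. -/
lemma levelWeight_le_of_lt {k l Q t : ℝ} (hkl : k < l) (hl : l - k ≤ 1) (hQ : 0 ≤ Q) (hQt : Q ≤ t)
    (x : Rn n) :
    levelWeight u Q l x ≤ 2 * (l - k) ^ (-t) * max (u x - k) 0 ^ t := by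
  have hh : 0 < l - k := by linarith
  have hw0 : 0 ≤ max (u x - k) 0 := le_max_right _ _
  unfold levelWeight
  split_ifs with hx
  · set w := max (u x - k) 0 with hw
    have hwh : l - k ≤ w := le_max_of_le_left (by linarith)
    have h1 : 1 ≤ w / (l - k) := by rwa [le_div_iff₀ hh, one_mul]
    have h2 : (w / (l - k)) ^ t = (l - k) ^ (-t) * w ^ t := by
      rw [Real.div_rpow hw0 hh.le, Real.rpow_neg hh.le]; ring
    have h3 : max (u x - l) 0 ^ Q ≤ (w / (l - k)) ^ t := by
      calc max (u x - l) 0 ^ Q ≤ (w / (l - k)) ^ Q := by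
            apply Real.rpow_le_rpow (le_max_right _ _) _ hQ
            have h4 : w ≤ w / (l - k) := by
              rw [le_div_iff₀ hh]; nlinarith
            refine le_trans (max_le_max (by linarith) le_rfl) h4
        _ ≤ _ := Real.rpow_le_rpow_of_exponent_le h1 hQt
    have h4 : 1 ≤ (w / (l - k)) ^ t := Real.one_le_rpow h1 (hQ.trans hQt)
    rw [mul_assoc, ← h2]
    linarith
  · positivity

/-- One step of the iteration. -/
lemma Admissible.exists_lintegral_levelWeight_le (h : Admissible s p K Λ τ P) (hn : 1 ≤ n)
    (hΩ : IsOpen Ω) (hΩb : Bornology.IsBounded Ω) (hu : IsWeakSolution s p K Ω u)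
    (hut : MemTail s p Ω u) (hR1 : R ≤ 1) (hball : Metric.ball x₀ R ⊆ Ω) (hq : 1 ≤ q)
    (hqP : q ≤ P) (hqQ : q ≤ Q) (hQκ : Q ≤ q * (1 + τ * q / n))
    (hqp : ∀ x ∈ Metric.ball x₀ R, ∀ y ∈ Metric.ball x₀ R, q ≤ p x y)
    (hpQ : ∀ x ∈ Metric.ball x₀ R, ∀ y ∈ Metric.ball x₀ R, p x y ≤ Q)
    (huQ : ∫⁻ x in Metric.ball x₀ R, ENNReal.ofReal (|u x| ^ Q) ≠ ∞) :
    ∃ C : ℝ, 0 < C ∧ ∀ k l r' r : ℝ, 0 ≤ k → k < l → l - k ≤ 1 → 0 < r' → r' < r → r ≤ R →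
      ∫⁻ x in Metric.ball x₀ r', ENNReal.ofReal (levelWeight u Q l x) ≤
        ENNReal.ofReal (C * (l - k) ^ (-(q * (1 + τ * q / n))) * (r - r') ^ (-((n : ℝ) + P))) *
          (∫⁻ x in Metric.ball x₀ r, ENNReal.ofReal (levelWeight u Q k x)) ^ (1 + τ * q / n) := by
  have hQ : 1 ≤ Q := hq.trans hqQ
  have hτ := h.τ_pos
  have hP := h.one_lt_P
  have hnpos : (0 : ℝ) < n := by exact_mod_cast hn
  obtain ⟨C₁, hC₁, hcacc⟩ := h.exists_caccioppoli hn hΩ hΩb hu hut hR1 hball hQ hpQ huQ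
  obtain ⟨C₂, hC₂, hsob⟩ := exists_lintegral_rpow_le_energy hn h.s_meas h.p_meas hτ h.τ_le hq
  set N : ℝ := (n : ℝ) + P with hN
  set κ : ℝ := 1 + τ * q / n with hκ
  refine ⟨2 * C₂ * (C₁ + 2) * 2 ^ N, by positivity, ?_⟩
  intro k l r' r hk hkl hlk hr' hr'r hrR
  set ρ := (r' + r) / 2 with hρ
  set δ := (r - r') / 2 with hδ
  have hδ0 : 0 < δ := by rw [hδ]; linarith
  have hδ1 : δ ≤ 1 := by rw [hδ]; linarith
  have hrρ : r - ρ = δ := by rw [hρ, hδ]; ring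
  have hρr' : ρ - r' = δ := by rw [hρ, hδ]; ring
  set w : Rn n → ℝ := fun x => max (u x - k) 0 with hw
  have hw0 : ∀ x, 0 ≤ w x := fun x => le_max_right _ _
  have hwm : AEMeasurable w volume :=
    (hu.memW.aemeasurable.sub_const k).max aemeasurable_const
  set Y := ∫⁻ x in Metric.ball x₀ r, ENNReal.ofReal (levelWeight u Q k x) with hY
  have hYtop : Y ≠ ∞ :=
    lintegral_levelWeight_ne_top (by linarith) hk huQ hrR
  have hsubρ : Metric.ball x₀ ρ ⊆ Metric.ball x₀ r := Metric.ball_subset_ball (by linarith)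
  have hsubR : Metric.ball x₀ ρ ⊆ Metric.ball x₀ R := Metric.ball_subset_ball (by linarith)
  have hNY : ∫⁻ y in Metric.ball x₀ ρ, ENNReal.ofReal (w y ^ q) ≤ Y := by
    refine le_trans (lintegral_mono fun x => ?_) (lintegral_mono_set hsubρ)
    exact ENNReal.ofReal_le_ofReal (rpow_le_levelWeight (by linarith) hqQ x)
  have hchi : (∫⁻ x in Metric.ball x₀ ρ, if w x = 0 then (0 : ℝ≥0∞) else 1) ≤ Y := by
    refine le_trans (lintegral_mono fun x => ?_) (lintegral_mono_set hsubρ)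
    change (if w x = 0 then (0 : ℝ≥0∞) else 1) ≤ ENNReal.ofReal (levelWeight u Q k x)
    split_ifs with hx
    · exact zero_le
    · have hux : k < u x := by
        by_contra hc
        exact hx (max_eq_right (by linarith))
      rw [← ENNReal.ofReal_one, levelWeight, if_pos hux]
      apply ENNReal.ofReal_le_ofReal
      have : 0 ≤ max (u x - k) 0 ^ Q := Real.rpow_nonneg (le_max_right _ _) _
      linarith
  have hen := hcacc k ρ r hk (by linarith) (by linarith) hrR
  have hS := hsob x₀ r' ρ hr' (by linarith) (by linarith)
    (fun x hx y hy => hqp x (hsubR hx) y (hsubR hy)) w hw0 hwm (ne_top_of_le_ne_top hYtop hNY)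
  rw [hrρ] at hen
  rw [hρr'] at hS
  have hδN : 1 ≤ δ ^ (-N) := Real.one_le_rpow_of_pos_of_le_one_of_nonpos hδ0 hδ1 (by
    have : 0 < N := by positivity
    linarith)
  have hδN' : δ ^ (-((n : ℝ) + τ * q)) ≤ δ ^ (-N) := by
    apply Real.rpow_le_rpow_of_exponent_ge hδ0 hδ1
    have h1 : τ ≤ 1 := by linarith [h.τ_le 0 0, h.τ_le' 0 0]
    have h2 : τ * q ≤ P := by nlinarith
    rw [hN]; linarith
  have hwint : ∫⁻ x in Metric.ball x₀ r', ENNReal.ofReal (w x ^ (q * κ)) ≤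
      ENNReal.ofReal (C₂ * (C₁ + 2) * δ ^ (-N)) * Y ^ κ := by
    refine hS.trans ?_
    -- Energy, measure of the superlevel set and lower-order term are each at most `δ ^ (-N) * Y` up
    -- to constants. Being linear in `Y`, they combine with the Sobolev factor to give the power `κ
    -- > 1`.
    calc _ ≤ ENNReal.ofReal C₂ * Y ^ (τ * q / n) *
          (ENNReal.ofReal (C₁ * δ ^ (-N)) * Y + ENNReal.ofReal (δ ^ (-N)) * Y
            + ENNReal.ofReal (δ ^ (-N)) * Y) := by
          gcongr
          refine hchi.trans (le_mul_of_one_le_left' ?_)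
          rw [← ENNReal.ofReal_one]
          exact ENNReal.ofReal_le_ofReal hδN
      _ = ENNReal.ofReal (C₂ * (C₁ + 2) * δ ^ (-N)) * Y ^ κ := by
          rw [hκ, ENNReal.rpow_add_of_nonneg _ _ zero_le_one (by positivity), ENNReal.rpow_one,
            mul_assoc C₂, ENNReal.ofReal_mul hC₂.le, add_mul, ENNReal.ofReal_add (by positivity)
            (by positivity), ENNReal.ofReal_mul (p := 2) (by norm_num), ENNReal.ofReal_ofNat]
          ring
  calc ∫⁻ x in Metric.ball x₀ r', ENNReal.ofReal (levelWeight u Q l x)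
      ≤ ∫⁻ x in Metric.ball x₀ r', ENNReal.ofReal (2 * (l - k) ^ (-(q * κ))) *
          ENNReal.ofReal (w x ^ (q * κ)) := by
        apply lintegral_mono
        intro x
        change _ ≤ ENNReal.ofReal (2 * (l - k) ^ (-(q * κ))) * ENNReal.ofReal (w x ^ (q * κ))
        have hlk0 : 0 < l - k := by linarith
        rw [← ENNReal.ofReal_mul (by positivity)]
        exact ENNReal.ofReal_le_ofReal (levelWeight_le_of_lt hkl hlk (by linarith) hQκ x)
    _ = ENNReal.ofReal (2 * (l - k) ^ (-(q * κ))) *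
          ∫⁻ x in Metric.ball x₀ r', ENNReal.ofReal (w x ^ (q * κ)) :=
        lintegral_const_mul' _ _ ENNReal.ofReal_ne_top
    _ ≤ ENNReal.ofReal (2 * (l - k) ^ (-(q * κ))) *
          (ENNReal.ofReal (C₂ * (C₁ + 2) * δ ^ (-N)) * Y ^ κ) := by gcongr
    _ = _ := by
        have hlk0 : 0 < l - k := by linarith
        rw [← mul_assoc, ← ENNReal.ofReal_mul (by positivity)]
        congr 2
        have h3 : δ ^ (-N) = 2 ^ N * (r - r') ^ (-N) := by
          rw [hδ, Real.div_rpow (by linarith) (by norm_num), Real.rpow_neg (x := 2) (by norm_num),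
            div_inv_eq_mul, mul_comm]
        rw [h3]
        ring

end

section

variable {n : ℕ} {s p K : Rn n → Rn n → ℝ} {Λ τ P Q q : ℝ} {u : Rn n → ℝ} {Ω : Set (Rn n)}
  {x₀ : Rn n} {R : ℝ}

/-! ### Local higher integrability -/

lemma lintegral_ball_energyDensity_lt_top (hu : MemW s p Ω u) (hball : Metric.ball x₀ R ⊆ Ω) :
    ∫⁻ z in Metric.ball x₀ R ×ˢ Metric.ball x₀ R, ENNReal.ofReal (energyDensity s p u z) < ∞ := by
  refine lt_of_le_of_lt (lintegral_mono_set ?_) hu.energy_lt_top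
  intro z hz hz'
  exact hz'.1 (hball hz.1)

/-- By Tonelli, finite energy on the product ball makes `y ↦ energyDensity s p u (x, y)` integrable
for a.e. `x`. Fix one such `x` and compare `u y` with the number `u x`; `R ≤ 1 / 2` keeps all
distances at most `1`. -/
lemma Admissible.lintegral_rpow_lt_top (h : Admissible s p K Λ τ P) (hu : MemW s p Ω u)
    (hR0 : 0 < R) (hR1 : R ≤ 1 / 2) (hball : Metric.ball x₀ R ⊆ Ω) (hq : 1 ≤ q)
    (hqp : ∀ x ∈ Metric.ball x₀ R, ∀ y ∈ Metric.ball x₀ R, q ≤ p x y) :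
    ∫⁻ x in Metric.ball x₀ R, ENNReal.ofReal (|u x| ^ q) < ∞ := by
  set B := Metric.ball x₀ R with hB
  have hBm : MeasurableSet B := Metric.isOpen_ball.measurableSet
  have hen := lintegral_ball_energyDensity_lt_top hu hball
  have hm := (aemeasurable_energyDensity h.s_meas h.p_meas hu.aemeasurable).ennreal_ofReal
  rw [Measure.volume_eq_prod] at hm hen
  rw [setLIntegral_prod _ hm.restrict] at hen
  have hm' : AEMeasurable (fun z : Rn n × Rn n => ENNReal.ofReal (energyDensity s p u z))
      ((volume.restrict B).prod (volume.restrict B)) := by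
    rw [Measure.prod_restrict]; exact hm.restrict
  have hae := ae_lt_top' hm'.lintegral_prod_right' hen.ne
  have hne : (ae (volume.restrict B)).NeBot := by
    rw [ae_restrict_neBot]
    exact (Metric.measure_ball_pos _ _ hR0).ne'
  obtain ⟨x, hx, hxB⟩ := (hae.and (ae_restrict_mem hBm)).exists
  have hpt : ∀ y ∈ B, ENNReal.ofReal (|u y| ^ q) ≤ ENNReal.ofReal (2 ^ q) *
      (ENNReal.ofReal (energyDensity s p u (x, y)) + ENNReal.ofReal (1 + |u x| ^ q)) := by
    intro y hy
    rw [← ENNReal.ofReal_add (energyDensity_nonneg _) (by positivity),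
      ← ENNReal.ofReal_mul (by positivity)]
    apply ENNReal.ofReal_le_ofReal
    have hxy : ‖x - y‖ ≤ 1 := by
      rw [← dist_eq_norm]
      have h1 := Metric.mem_ball.1 hxB
      have h2 := Metric.mem_ball'.1 hy
      linarith [dist_triangle x x₀ y]
    have h1 := abs_sub_rpow_le_energyDensity (v := u) h.τ_pos h.τ_le hq (hqp x hxB y hy) hxy le_rfl
    rw [Real.one_rpow, Real.one_rpow, one_mul] at h1
    have h2 : |u y| ^ q ≤ (|u x - u y| + |u x|) ^ q := by
      apply Real.rpow_le_rpow (abs_nonneg _) _ (by linarith)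
      have := abs_sub (u x) (u x - u y)
      rw [sub_sub_cancel] at this
      linarith
    refine (h2.trans (add_rpow_le (abs_nonneg _) (abs_nonneg _) (by linarith))).trans ?_
    apply mul_le_mul_of_nonneg_left _ (by positivity)
    linarith
  refine lt_of_le_of_lt (setLIntegral_mono' hBm hpt) ?_
  rw [lintegral_const_mul' _ _ ENNReal.ofReal_ne_top, lintegral_add_right _ measurable_const,
    setLIntegral_const]
  exact ENNReal.mul_lt_top ENNReal.ofReal_lt_top (ENNReal.add_lt_top.2
    ⟨hx, ENNReal.mul_lt_top ENNReal.ofReal_lt_top measure_ball_lt_top⟩)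

/-- One application of the Sobolev inequality to `|u|`, whose energy is no larger than that of `u`,
reaches the exponent `Q`. This makes the level weights integrable and starts the iteration. -/
lemma Admissible.lintegral_rpow_half_ne_top (h : Admissible s p K Λ τ P) (hn : 1 ≤ n)
    (hu : MemW s p Ω u) (hR0 : 0 < R) (hR1 : R ≤ 1 / 2) (hball : Metric.ball x₀ R ⊆ Ω)
    (hq : 1 ≤ q) (hQ : 0 ≤ Q) (hQκ : Q ≤ q * (1 + τ * q / n))
    (hqp : ∀ x ∈ Metric.ball x₀ R, ∀ y ∈ Metric.ball x₀ R, q ≤ p x y) :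
    ∫⁻ x in Metric.ball x₀ (R / 2), ENNReal.ofReal (|u x| ^ Q) ≠ ∞ := by
  have hτ := h.τ_pos
  obtain ⟨C, -, hsob⟩ := exists_lintegral_rpow_le_energy hn h.s_meas h.p_meas hτ h.τ_le hq
  have hNt := h.lintegral_rpow_lt_top hu hR0 hR1 hball hq hqp
  have hS := hsob x₀ (R / 2) R (by linarith) (by linarith) (by linarith) hqp (fun x => |u x|)
    (fun x => abs_nonneg _) hu.aemeasurable.abs hNt.ne
  have hen : ∫⁻ z in Metric.ball x₀ R ×ˢ Metric.ball x₀ R,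
      ENNReal.ofReal (energyDensity s p (fun x => |u x|) z) < ∞ := by
    refine lt_of_le_of_lt (lintegral_mono fun z => ENNReal.ofReal_le_ofReal ?_)
      (lintegral_ball_energyDensity_lt_top hu hball)
    have hp := h.one_lt_p z.1 z.2
    exact div_le_div_of_nonneg_right (Real.rpow_le_rpow (abs_nonneg _)
      (abs_abs_sub_abs_le (u z.1) (u z.2)) (by linarith)) (by positivity)
  have hchi : (∫⁻ x in Metric.ball x₀ R, if |u x| = 0 then (0 : ℝ≥0∞) else 1) < ∞ := by
    refine lt_of_le_of_lt (lintegral_mono (g := fun _ => 1) fun x => ?_) ?_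
    · change (if |u x| = 0 then (0 : ℝ≥0∞) else 1) ≤ 1
      split_ifs <;> simp
    · rw [setLIntegral_one]; exact measure_ball_lt_top
  have hfin : ∫⁻ x in Metric.ball x₀ (R / 2), ENNReal.ofReal (|u x| ^ (q * (1 + τ * q / n))) < ∞ := by
    refine lt_of_le_of_lt hS (ENNReal.mul_lt_top (ENNReal.mul_lt_top ENNReal.ofReal_lt_top
      (ENNReal.rpow_lt_top_of_nonneg (by positivity) hNt.ne)) (ENNReal.add_lt_top.2
      ⟨ENNReal.add_lt_top.2 ⟨hen, hchi⟩, ENNReal.mul_lt_top ENNReal.ofReal_lt_top hNt⟩))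
  refine ne_of_lt ?_
  calc ∫⁻ x in Metric.ball x₀ (R / 2), ENNReal.ofReal (|u x| ^ Q)
      ≤ ∫⁻ x in Metric.ball x₀ (R / 2), (ENNReal.ofReal (|u x| ^ (q * (1 + τ * q / n))) + 1) := by
        apply lintegral_mono
        intro x
        change ENNReal.ofReal (|u x| ^ Q) ≤ ENNReal.ofReal (|u x| ^ (q * (1 + τ * q / n))) + 1
        rw [← ENNReal.ofReal_one, ← ENNReal.ofReal_add (by positivity) zero_le_one]
        exact ENNReal.ofReal_le_ofReal (rpow_le_one_add_rpow (abs_nonneg _) hQ hQκ)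
    _ < ∞ := by
        rw [lintegral_add_right _ measurable_const, setLIntegral_one]
        exact ENNReal.add_lt_top.2 ⟨hfin, measure_ball_lt_top⟩

/-! ### Local boundedness from above -/

/-- Dominated convergence; supplies the small initial quantity that fast geometric convergence
demands. -/
lemma tendsto_lintegral_levelWeight (hu : AEMeasurable u volume) (hQ : 0 ≤ Q)
    (huQ : ∫⁻ x in Metric.ball x₀ R, ENNReal.ofReal (|u x| ^ Q) ≠ ∞) :
    Tendsto (fun k : ℕ => ∫⁻ x in Metric.ball x₀ R, ENNReal.ofReal (levelWeight u Q k x))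
      atTop (𝓝 0) := by
  have h0 : ∫⁻ _ in Metric.ball x₀ R, (0 : ℝ≥0∞) = 0 := lintegral_zero
  rw [← h0]
  apply tendsto_lintegral_of_dominated_convergence' (fun x => ENNReal.ofReal (|u x| ^ Q + 1))
  · intro k
    exact (aemeasurable_levelWeight hu).ennreal_ofReal.restrict
  · intro k
    exact Eventually.of_forall fun x =>
      ENNReal.ofReal_le_ofReal (levelWeight_le hQ (Nat.cast_nonneg k) x)
  · have h1 : ∀ x, ENNReal.ofReal (|u x| ^ Q + 1) = ENNReal.ofReal (|u x| ^ Q) + 1 := fun x => by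
      rw [ENNReal.ofReal_add (by positivity) zero_le_one, ENNReal.ofReal_one]
    simp only [h1]
    rw [lintegral_add_right _ measurable_const, setLIntegral_one]
    exact ENNReal.add_ne_top.2 ⟨huQ, measure_ball_lt_top.ne⟩
  · refine Eventually.of_forall fun x => ?_
    apply tendsto_const_nhds.congr'
    filter_upwards [eventually_ge_atTop ⌈u x⌉₊] with k hk
    have : u x ≤ k := Nat.ceil_le.1 hk
    rw [levelWeight, if_neg (not_lt.2 this), ENNReal.ofReal_zero]

lemma Admissible.exists_ae_le_ball (h : Admissible s p K Λ τ P) (hn : 1 ≤ n)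
    (hΩ : IsOpen Ω) (hΩb : Bornology.IsBounded Ω) (hu : IsWeakSolution s p K Ω u)
    (hut : MemTail s p Ω u) (hR0 : 0 < R) (hR1 : R ≤ 1) (hball : Metric.ball x₀ R ⊆ Ω)
    (hq : 1 ≤ q) (hqP : q ≤ P) (hqQ : q ≤ Q) (hQκ : Q ≤ q * (1 + τ * q / n))
    (hqp : ∀ x ∈ Metric.ball x₀ R, ∀ y ∈ Metric.ball x₀ R, q ≤ p x y)
    (hpQ : ∀ x ∈ Metric.ball x₀ R, ∀ y ∈ Metric.ball x₀ R, p x y ≤ Q)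
    (huQ : ∫⁻ x in Metric.ball x₀ R, ENNReal.ofReal (|u x| ^ Q) ≠ ∞) :
    ∃ k : ℝ, ∀ᵐ x ∂volume.restrict (Metric.ball x₀ (R / 2)), u x ≤ k := by
  have hτ := h.τ_pos
  have hP := h.one_lt_P
  have hnpos : (0 : ℝ) < n := by exact_mod_cast hn
  obtain ⟨C, hC, hstep⟩ := h.exists_lintegral_levelWeight_le hn hΩ hΩb hu hut hR1 hball hq hqP hqQ
    hQκ hqp hpQ huQ
  set κ : ℝ := 1 + τ * q / n with hκ
  have hκ1 : 1 < κ := by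
    have : 0 < τ * q / n := by positivity
    linarith
  set t : ℝ := q * κ with ht
  have ht0 : 0 < t := by positivity
  set N : ℝ := (n : ℝ) + P with hN
  have hN0 : 0 < N := by positivity
  -- At step `j` the levels differ by `2⁻ʲ / 2` and the radii by `R / 4 * 2⁻ʲ`. Their powers `-t`
  -- and `-N` produce this constant and the base `2 ^ (t + N)`.
  obtain ⟨ε, hε, hiter⟩ := exists_tendsto_zero_of_iterate_le
    (C := C * 2 ^ t * (R / 4) ^ (-N)) (b := 2 ^ (t + N)) (κ := κ) (by positivity)
    (Real.one_lt_rpow (by norm_num) (by positivity)) hκ1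
  have hlim := tendsto_lintegral_levelWeight hu.memW.aemeasurable (by linarith : 0 ≤ Q) huQ
  obtain ⟨k, hk⟩ := (hlim.eventually_le_const (ENNReal.ofReal_pos.2 hε)).exists
  refine ⟨k + 1, ?_⟩
  set Y : ℕ → ℝ≥0∞ := fun j => ∫⁻ x in Metric.ball x₀ (R / 2 * (1 + (1 / 2) ^ j)),
    ENNReal.ofReal (levelWeight u Q (k + 1 - (1 / 2) ^ j) x) with hY
  have hYlim : Tendsto Y atTop (𝓝 0) := by
    apply hiter
    · have h1 : R / 2 * (1 + (1 / 2) ^ 0) = R := by ring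
      have h2 : (k : ℝ) + 1 - (1 / 2) ^ 0 = k := by ring
      simp only [hY]
      rw [h1, h2]
      exact hk
    · intro j
      have hj0 : (0 : ℝ) < (1 / 2) ^ j := by positivity
      have hj1 : ((1 : ℝ) / 2) ^ j ≤ 1 := pow_le_one₀ (by norm_num) (by norm_num)
      have hpow : ((1 : ℝ) / 2) ^ (j + 1) = (1 / 2) ^ j / 2 := by rw [pow_succ]; ring
      have hl : (k + 1 - (1 / 2 : ℝ) ^ (j + 1)) - (k + 1 - (1 / 2) ^ j) = (1 / 2) ^ j / 2 := by
        rw [hpow]; ring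
      have hr : R / 2 * (1 + (1 / 2) ^ j) - R / 2 * (1 + (1 / 2) ^ (j + 1))
          = R / 4 * (1 / 2) ^ j := by rw [hpow]; ring
      have hst := hstep (k + 1 - (1 / 2) ^ j) (k + 1 - (1 / 2) ^ (j + 1))
        (R / 2 * (1 + (1 / 2) ^ (j + 1))) (R / 2 * (1 + (1 / 2) ^ j))
        (by have : (0 : ℝ) ≤ k := Nat.cast_nonneg k
            linarith) (by linarith) (by linarith)
        (by positivity) (by have : 0 < R / 4 * (1 / 2) ^ j := by positivity
                            linarith) (by nlinarith)
      refine hst.trans (le_of_eq ?_)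
      simp only [hY]
      congr 2
      rw [hl, hr]
      have h2 : ∀ c : ℝ, ((1 / 2 : ℝ) ^ j) ^ (-c) = (2 ^ c) ^ j := by
        intro c
        rw [one_div, inv_pow, Real.inv_rpow (by positivity), Real.rpow_neg (by positivity),
          inv_inv, ← Real.rpow_natCast, ← Real.rpow_natCast, ← Real.rpow_mul (by norm_num),
          ← Real.rpow_mul (by norm_num), mul_comm]
      rw [Real.div_rpow hj0.le (by norm_num), Real.mul_rpow (by positivity) hj0.le, h2, h2,
        Real.rpow_neg (x := 2) (by norm_num), div_inv_eq_mul, Real.rpow_add (x := 2) (by norm_num) t N, mul_pow]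
      ring
  -- All levels stay below `k + 1` and all radii above `R / 2`, and the weight is at least `1` where
  -- `u > k + 1`; so each `Y j` bounds the measure of this set.
  have hmeas : ∀ j, volume.restrict (Metric.ball x₀ (R / 2)) {x | ¬ u x ≤ k + 1} ≤ Y j := by
    intro j
    have hj0 : (0 : ℝ) < (1 / 2) ^ j := by positivity
    have hnull : NullMeasurableSet {x | ¬ u x ≤ k + 1} (volume.restrict (Metric.ball x₀ (R / 2))) :=
      (nullMeasurableSet_le hu.memW.aemeasurable.restrict aemeasurable_const).compl
    rw [← lintegral_indicator_one₀ hnull]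
    refine le_trans (lintegral_mono fun x => ?_) (lintegral_mono_set
      (Metric.ball_subset_ball (by nlinarith)))
    by_cases hx : u x ≤ k + 1
    · rw [Set.indicator_of_notMem (by simpa using hx)]; exact zero_le
    · rw [Set.indicator_of_mem (by simpa using hx)]
      push Not at hx
      rw [levelWeight, if_pos (by linarith), Pi.one_apply, ← ENNReal.ofReal_one]
      apply ENNReal.ofReal_le_ofReal
      have : 0 ≤ max (u x - (k + 1 - (1 / 2) ^ j)) 0 ^ Q := Real.rpow_nonneg (le_max_right _ _) _
      linarith
  exact le_antisymm (ge_of_tendsto' hYlim hmeas) zero_le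

/-- Solutions are bounded above near every point of the domain. -/
lemma Admissible.exists_ae_le_nhds (h : Admissible s p K Λ τ P) (hn : 1 ≤ n)
    (hΩ : IsOpen Ω) (hΩb : Bornology.IsBounded Ω)
    (hω : Tendsto (fun r : ℝ => oscDiag p Ω r) (𝓝[>] 0) (𝓝 0))
    (hu : IsWeakSolution s p K Ω u) (hut : MemTail s p Ω u) (hx₀ : x₀ ∈ Ω) :
    ∃ r > 0, ∃ k : ℝ, ∀ᵐ x ∂volume.restrict (Metric.ball x₀ r), u x ≤ k := by
  have hτ := h.τ_pos
  have hnpos : (0 : ℝ) < n := by exact_mod_cast hn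
  -- Half of the smallest possible Sobolev gain `τ * q ^ 2 / n`, attained at `q = 1`: the exponents
  -- may deviate from `p x₀ x₀` by `ε` in either direction.
  set ε : ℝ := τ / (2 * n) with hε
  have hε0 : 0 < ε := by positivity
  obtain ⟨r₁, hr₁, hball₁⟩ := Metric.isOpen_iff.1 hΩ x₀ hx₀
  have hev : ∀ᶠ r in 𝓝[>] (0 : ℝ), oscDiag p Ω r ≤ ENNReal.ofReal ε :=
    hω.eventually_le_const (ENNReal.ofReal_pos.2 hε0)
  have hev2 : ∀ᶠ r in 𝓝[>] (0 : ℝ), 0 < r ∧ r < min r₁ (1 / 2) :=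
    Ioo_mem_nhdsGT (lt_min hr₁ (by norm_num))
  obtain ⟨R, hosc, hR0, hRmin⟩ := (hev.and hev2).exists
  have hR1 : R ≤ 1 / 2 := (hRmin.trans_le (min_le_right _ _)).le
  have hball : Metric.ball x₀ R ⊆ Ω :=
    (Metric.ball_subset_ball (hRmin.trans_le (min_le_left _ _)).le).trans hball₁
  have hmem : x₀ ∈ Metric.ball x₀ R := Metric.mem_ball_self hR0
  have hp : ∀ x ∈ Metric.ball x₀ R, ∀ y ∈ Metric.ball x₀ R, |p x y - p x₀ x₀| ≤ ε := by
    intro x hx y hy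
    rw [← ENNReal.ofReal_le_ofReal_iff hε0.le]
    refine le_trans ?_ hosc
    refine le_iSup₂_of_le x₀ hball ?_
    refine le_iSup₂_of_le x hx ?_
    refine le_iSup₂_of_le y hy ?_
    refine le_iSup₂_of_le x₀ hmem ?_
    exact le_iSup₂_of_le x₀ hmem le_rfl
  -- The maximum keeps `q ≥ 1`; it is still a lower exponent since `p > 1`.
  set q : ℝ := max 1 (p x₀ x₀ - ε) with hqdef
  set Q : ℝ := p x₀ x₀ + ε with hQdef
  have hp₀ := h.one_lt_p x₀ x₀
  have hp₀' := h.p_le x₀ x₀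
  have hq : 1 ≤ q := le_max_left _ _
  have hqp₀ : q ≤ p x₀ x₀ := max_le hp₀.le (by linarith)
  have hqp : ∀ x ∈ Metric.ball x₀ R, ∀ y ∈ Metric.ball x₀ R, q ≤ p x y := fun x hx y hy =>
    max_le (h.one_lt_p x y).le (by have := (abs_le.1 (hp x hx y hy)).1; linarith)
  have hpQ : ∀ x ∈ Metric.ball x₀ R, ∀ y ∈ Metric.ball x₀ R, p x y ≤ Q := fun x hx y hy => by
    have := (abs_le.1 (hp x hx y hy)).2
    linarith
  -- The gain is `2 * ε * q ^ 2 ≥ 2 * ε`, while `Q - q ≤ 2 * ε`.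
  have hQκ : Q ≤ q * (1 + τ * q / n) := by
    have h1 : τ / n = 2 * ε := by rw [hε]; field_simp
    have h2 : q * (1 + τ * q / n) = q + τ / n * (q * q) := by ring
    have h3 : p x₀ x₀ - ε ≤ q := le_max_right _ _
    have h4 : 1 ≤ q * q := by nlinarith
    rw [h2, h1]
    nlinarith
  have huQ := h.lintegral_rpow_half_ne_top hn hu.memW hR0 hR1 hball hq (by linarith : 0 ≤ Q) hQκ hqp
  have hsub : Metric.ball x₀ (R / 2) ⊆ Metric.ball x₀ R := Metric.ball_subset_ball (by linarith)
  obtain ⟨k, hk⟩ := h.exists_ae_le_ball hn hΩ hΩb hu hut (by linarith : 0 < R / 2) (by linarith)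
    (hsub.trans hball) hq (hqp₀.trans hp₀') (by linarith) hQκ
    (fun x hx y hy => hqp x (hsub hx) y (hsub hy)) (fun x hx y hy => hpQ x (hsub hx) y (hsub hy))
    huQ
  exact ⟨R / 2 / 2, by linarith, k, hk⟩

/-! ### Reflection and conclusion -/

lemma MemW.neg (hu : MemW s p Ω u) : MemW s p Ω (fun x => -u x) := by
  refine ⟨hu.aemeasurable.neg, hu.memLp.neg, ?_⟩
  have h1 : ∀ z : Rn n × Rn n, |-u z.1 - -u z.2| = |u z.1 - u z.2| := fun z => by
    rw [neg_sub_neg, abs_sub_comm]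
  simp only [h1]
  exact hu.energy_lt_top

lemma IsWeakSolution.neg (hu : IsWeakSolution s p K Ω u) :
    IsWeakSolution s p K Ω (fun x => -u x) := by
  refine ⟨hu.memW.neg, fun φ hφ hφ0 => ?_⟩
  have h1 : ∀ z : Rn n × Rn n, |-u z.1 - -u z.2| ^ (p z.1 z.2 - 2) * (-u z.1 - -u z.2) *
      (φ z.1 - φ z.2) * K z.1 z.2 = -(|u z.1 - u z.2| ^ (p z.1 z.2 - 2) * (u z.1 - u z.2) *
      (φ z.1 - φ z.2) * K z.1 z.2) := fun z => by
    rw [neg_sub_neg, abs_sub_comm]; ring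
  simp only [h1]
  rw [integral_neg, hu.weak_form φ hφ hφ0, neg_zero]

lemma MemTail.neg (hu : MemTail s p Ω u) : MemTail s p Ω (fun x => -u x) := by
  refine ⟨hu.aemeasurable.neg, ?_⟩
  simp only [abs_neg]
  exact hu.essSup_lt_top

/-- Upper bounds for `u` and `-u` near each point give local two-sided bounds, and finitely many of
the balls cover the compact set. -/
lemma Admissible.memLinftyLoc (h : Admissible s p K Λ τ P) (hn : 1 ≤ n)
    (hΩ : IsOpen Ω) (hΩb : Bornology.IsBounded Ω)
    (hω : Tendsto (fun r : ℝ => oscDiag p Ω r) (𝓝[>] 0) (𝓝 0))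
    (hu : IsWeakSolution s p K Ω u) (hut : MemTail s p Ω u) : MemLinftyLoc Ω u := by
  intro D hD hDΩ
  have hloc : ∀ x ∈ D, ∃ r > 0, ∃ k : ℝ,
      ∀ᵐ y ∂volume.restrict (Metric.ball x r), ‖u y‖ ≤ k := by
    intro x hx
    obtain ⟨r₁, hr₁, k₁, hk₁⟩ := h.exists_ae_le_nhds hn hΩ hΩb hω hu hut (hDΩ hx)
    obtain ⟨r₂, hr₂, k₂, hk₂⟩ := h.exists_ae_le_nhds hn hΩ hΩb hω hu.neg hut.neg (hDΩ hx)
    refine ⟨min r₁ r₂, lt_min hr₁ hr₂, max k₁ k₂, ?_⟩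
    filter_upwards [ae_restrict_of_ae_restrict_of_subset
      (Metric.ball_subset_ball (min_le_left r₁ r₂)) hk₁, ae_restrict_of_ae_restrict_of_subset
      (Metric.ball_subset_ball (min_le_right r₁ r₂)) hk₂] with y h1 h2
    rw [Real.norm_eq_abs, abs_le]
    exact ⟨by linarith [le_max_right k₁ k₂], h1.trans (le_max_left _ _)⟩
  have hbound : ∃ k : ℝ, ∀ᵐ y ∂volume.restrict D, ‖u y‖ ≤ k := by
    refine hD.induction_on (p := fun A => ∃ k : ℝ, ∀ᵐ y ∂volume.restrict A, ‖u y‖ ≤ k) ?_ ?_ ?_ ?_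
    · exact ⟨0, by simp⟩
    · rintro A B hAB ⟨k, hk⟩
      exact ⟨k, ae_restrict_of_ae_restrict_of_subset hAB hk⟩
    · rintro A B ⟨k, hk⟩ ⟨l, hl⟩
      refine ⟨max k l, ?_⟩
      rw [ae_restrict_union_iff]
      exact ⟨hk.mono fun y hy => hy.trans (le_max_left _ _),
        hl.mono fun y hy => hy.trans (le_max_right _ _)⟩
    · intro x hx
      obtain ⟨r, hr, k, hk⟩ := hloc x hx
      exact ⟨Metric.ball x r, mem_nhdsWithin_of_mem_nhds (Metric.ball_mem_nhds x hr), k, hk⟩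
  obtain ⟨k, hk⟩ := hbound
  exact memLp_top_of_bound hu.memW.aemeasurable.aestronglyMeasurable.restrict k hk

end

end VarFrac

theorem theorem1p1 {n : ℕ} (hn : 2 ≤ n)
    {Ω : Set (VarFrac.Rn n)} (hΩ : IsOpen Ω) (hΩb : Bornology.IsBounded Ω)
    {s p K : VarFrac.Rn n → VarFrac.Rn n → ℝ}
    (hs_meas : VarFrac.LebesgueMeasurable₂ s) (hp_meas : VarFrac.LebesgueMeasurable₂ p)
    (hK_meas : VarFrac.LebesgueMeasurable₂ K)
    (hs_symm : VarFrac.Symmetric₂ s) (hp_symm : VarFrac.Symmetric₂ p)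
    (hK_symm : VarFrac.Symmetric₂ K)
    (hs : VarFrac.IsVariableOrder s) (hp : VarFrac.IsVariableExponent p)
    {Λ : ℝ} (hΛ : 1 < Λ) (hK : VarFrac.KernelBounds s p K Λ)
    (hω : Tendsto (fun r : ℝ => VarFrac.oscDiag p Ω r) (𝓝[>] 0) (𝓝 0))
    {u : VarFrac.Rn n → ℝ} (hu : VarFrac.IsWeakSolution s p K Ω u)
    (hu_tail : VarFrac.MemTail s p Ω u) :
    VarFrac.MemLinftyLoc Ω u := by
  obtain ⟨s₀, s₁, hs₀, hs₁, hs₀pos, hs₁lt⟩ := hs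
  obtain ⟨p₀, p₁, hp₀, hp₁, hp₀lt⟩ := hp
  have hs₀' : ∀ x y, s₀ ≤ s x y := fun x y => hs₀.1 ⟨(x, y), rfl⟩
  have hs₁' : ∀ x y, s x y ≤ s₁ := fun x y => hs₁.1 ⟨(x, y), rfl⟩
  -- The minimum bounds both `s` and `1 - s` from below: the first controls decay at infinity, the
  -- second the singularity on the diagonal.
  have hadm : VarFrac.Admissible s p K Λ (min s₀ (1 - s₁)) p₁ :=
    { s_meas := hs_meas
      p_meas := hp_meas
      K_meas := hK_meas
      s_symm := hs_symm
      p_symm := hp_symm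
      τ_pos := lt_min hs₀pos (by linarith)
      τ_le := fun x y => (min_le_left _ _).trans (hs₀' x y)
      τ_le' := fun x y => (min_le_right _ _).trans (by linarith [hs₁' x y])
      one_lt_p := fun x y => hp₀lt.trans_le (hp₀.1 ⟨(x, y), rfl⟩)
      p_le := fun x y => hp₁.1 ⟨(x, y), rfl⟩
      one_lt_Λ := hΛ
      bounds := hK }
  exact hadm.memLinftyLoc (by omega) hΩ hΩb hω hu hu_tail
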